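/- Let $X$ be a compact connected Hausdorff abelian topological group of finite (Lebesgue covering) dimension $\dim X = d < \infty$, let $m$ be the normalized Haar measure on $X$, and let $\mathcal{B}$ be the $m$-completion of the Borel $\sigma$-algebra of $X$. An epimorphism of $X$ is a continuous surjective homomorphism $X \to X$. A finite set $E$ of epimorphisms of $X$ is called mixing if $|E| > 1$ and, for every family of sets $B_\gamma \in \mathcal{B}$, $\gamma \in E$, $$ m\Bigl(\bigcap_{\gamma\in E} \gamma^{-n}(B_\gamma)\Bigr) \longrightarrow \prod_{\gamma\in E} m(B_\gamma) \qquad (n\to\infty), $$ where $\gamma^{-n}(B)$ denotes the preimage of $B$ under the $n$-th iterate of $\gamma$. Let $F$ be a finite set of epimorphisms of $X$ with $|F| > d$. Then $F$ is mixing if and only if every subset $E \subseteq F$ with $|E| = d+1$ is mixing. -/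

import Mathlib

open MeasureTheory Filter Topology

/-- `X` has Lebesgue covering dimension at most `n`: every finite open cover of `X` has a finite
open refinement such that each point of `X` lies in at most `n + 1` members of the refinement. -/
def HasCoveringDimLE (X : Type*) [TopologicalSpace X] (n : ℕ) : Prop :=
  ∀ U : Set (Set X), U.Finite → (∀ u ∈ U, IsOpen u) → ⋃₀ U = Set.univ →
    ∃ V : Set (Set X), V.Finite ∧ (∀ v ∈ V, IsOpen v) ∧ ⋃₀ V = Set.univ ∧
      (∀ v ∈ V, ∃ u ∈ U, v ⊆ u) ∧
      ∀ x : X, {v ∈ V | x ∈ v}.encard ≤ (n : ℕ∞) + 1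

/-- The Lebesgue covering dimension of a nonempty topological space, the least `n` such that
`X` has covering dimension at most `n`, and `⊤` if there is no such `n`. -/
noncomputable def coveringDim (X : Type*) [TopologicalSpace X] : ℕ∞ :=
  ⨅ (n : ℕ) (_ : HasCoveringDimLE X n), (n : ℕ∞)

/-- A finite set `F` of continuous endomorphisms, with at least two elements, is mixing for `m` if
`m (⋂ γ ∈ F, γ⁻ⁿ (B γ)) → ∏ γ ∈ F, m (B γ)` as `n → ∞`, for all sets `B γ`, `γ ∈ F`, in the
`m`-completion of the Borel sigma-algebra. Here `γ⁻ⁿ` is the preimage under the `n`-th iterate. -/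
def IsMixingSet {X : Type*} [CommGroup X] [TopologicalSpace X] [MeasurableSpace X]
    (m : Measure X) (F : Finset (X →ₜ* X)) : Prop :=
  1 < F.card ∧
    ∀ B : (X →ₜ* X) → Set X, (∀ γ ∈ F, NullMeasurableSet (B γ) m) →
      Tendsto (fun n : ℕ => m (⋂ γ ∈ F, (⇑γ)^[n] ⁻¹' B γ)) atTop (𝓝 (∏ γ ∈ F, m (B γ)))

/-!
A tuple of characters `χ γ`, `γ ∈ F`, is a relation at time `n` if `∏ γ ∈ F, χ γ ∘ γ^[n] = 1`. The
set `F` is mixing exactly when `1 < F.card` and no nontrivial tuple is a relation for infinitely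
many `n`: characters integrate to zero unless trivial, their span is dense in `C(X, ℂ)`, and
continuous functions approximate indicators in `L¹`; see `IsMixingSet.eventually_prod_ne_one` and
`isMixingSet_of_eventually_prod_ne_one`. A subset with at least two elements of a mixing set is
mixing, and for `d = 0` the group is trivial. So everything depends on the converse: a nontrivial
tuple on `F` which is a relation infinitely often has to be replaced by one supported on `d + 1`
elements of `F` (`exists_infinite_relations_of_infinite_relations`).

The character group `A` is torsion free because `X` is connected, and `V = ℚ ⊗ A` has dimension at
most `d`. The dual endomorphisms act on `V` injectively, and a relation at time `n` says that the
`n`-th iterate of a vector of `V ^ F` under a diagonal automorphism has coordinate sum zero. By the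
Skolem–Mahler–Lech theorem (`exists_forall_linearMap_pow_eq_zero`, by interpolating the orbit
`p`-adically) the relations hold for all `n` in an arithmetic progression. Along it, the vectors for
which all the relations hold form an invariant subspace of `V ^ F`, so that there is one with an
irreducible annihilating polynomial `π` over `ℚ`. Its coordinates can be multiplied separately by
elements of the field `ℚ[X] / (π)`, and as `V` has dimension at most `d`, any `d + 1` nonzero
coordinates have multiples, not all zero, which satisfy the relations (`exists_shorter_relation`).

The bound on the rank of `A` is where the covering dimension enters. If `A` had `d + 1` independent
characters, a combination of one-parameter subgroups would embed a cube of dimension `d + 1` in `X`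
(`rank_rationalized_characters_le`), which Lebesgue's covering theorem forbids
(`not_hasCoveringDimLE_of_injOn`). That theorem is proved analytically: a smooth partition of unity
subordinate to a fine cover, at most `d + 1` of whose members meet in a point, yields a map near the
identity of the cube whose Jacobian vanishes, while the integral of the Jacobian does not change
under perturbations inside a bounded set.

Two facts of Pontryagin duality are needed. Characters separate points (`exists_character_ne_one`),
by Gelfand duality for the commutative bicommutant of the translations of `L²`. Every
homomorphism from the character group to the circle is evaluation at a point (`exists_eval_eq`), by
uniqueness of the Fourier coefficients of a measure on the group of all such homomorphisms.
-/

set_option linter.unusedSectionVars false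
set_option linter.overlappingInstances false
set_option linter.style.haveILetI false

/-! ### Characters of a compact abelian group separate points -/

/-- The characters of a commutative C⋆-algebra separate its points, by Gelfand duality. -/
theorem exists_starAlgHom_apply_ne_zero {B : Type*} [CommCStarAlgebra B] (a : B) (ha : a ≠ 0) :
    ∃ φ : B →⋆ₐ[ℂ] ℂ, Continuous φ ∧ φ a ≠ 0 := by
  by_contra! hcon
  apply ha
  have hz : WeakDual.gelfandTransform ℂ B a = WeakDual.gelfandTransform ℂ B 0 := by
    refine ContinuousMap.ext fun φ => ?_
    rw [map_zero]
    exact hcon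
      { (WeakDual.CharacterSpace.toAlgHom φ : B →ₐ[ℂ] ℂ) with
        map_star' := fun x => map_star φ x } (map_continuous φ)
  exact (gelfandTransform_isometry B).injective hz

/-- A nonzero element `a` of the bicommutant of a commuting star-closed set in a C⋆-algebra is not
killed by some character of the (commutative) bicommutant. -/
theorem exists_characterSpace_bicommutant_ne_zero {𝔄 : Type*} [CStarAlgebra 𝔄] (S : Set 𝔄)
    (hstar : ∀ a ∈ S, star a ∈ S) (hcomm : ∀ a ∈ S, ∀ b ∈ S, a * b = b * a)
    (a : StarSubalgebra.centralizer ℂ (StarSubalgebra.centralizer ℂ S : Set 𝔄)) (ha : a ≠ 0) :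
    ∃ φ : StarSubalgebra.centralizer ℂ (StarSubalgebra.centralizer ℂ S : Set 𝔄) →⋆ₐ[ℂ] ℂ,
      Continuous φ ∧ φ a ≠ 0 := by
  let B := StarSubalgebra.centralizer ℂ (StarSubalgebra.centralizer ℂ S : Set 𝔄)
  have hunion : S ∪ star S = S := by
    apply Set.union_eq_left.2
    intro x hx
    simpa using hstar _ hx
  have hBset : (B : Set 𝔄) = S.centralizer.centralizer := by
    rw [StarSubalgebra.coe_centralizer_centralizer, hunion]
  have hclosed : IsClosed (B : Set 𝔄) := by
    rw [hBset]; exact Set.isClosed_centralizer _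
  let _ : CommCStarAlgebra B :=
    { StarSubalgebra.cstarAlgebra B with
      mul_comm := fun x y => Subtype.ext (by
        have hx : (x : 𝔄) ∈ S.centralizer.centralizer := by rw [← hBset]; exact x.2
        have hy : (y : 𝔄) ∈ S.centralizer.centralizer := by rw [← hBset]; exact y.2
        exact Set.centralizer_centralizer_comm_of_comm hcomm _ hx _ hy) }
  exact exists_starAlgHom_apply_ne_zero a ha

/-- Let `U` be a unitary representation of an abelian group, and `T` an element of its bicommutant
with `y ↦ U y * T` norm continuous. If `U x` acts nontrivially on `T`, then some continuous
character is nontrivial at `x`: take `y ↦ φ (U y)`, where `φ` is a character of the bicommutant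
with `φ ((U x - 1) T) ≠ 0`. It is continuous as `φ (U y) = φ (U y * T) / φ T`. -/
theorem exists_character_of_starRep {X 𝔄 : Type*} [CommGroup X] [TopologicalSpace X]
    [CStarAlgebra 𝔄] (U : X →* 𝔄) (hU : ∀ y, star (U y) = U y⁻¹) (t : 𝔄)
    (ht : ∀ R : 𝔄, (∀ y, U y * R = R * U y) → t * R = R * t)
    (htc : Continuous fun y => U y * t) {x : X} (hx : U x * t ≠ t) :
    ∃ χ : X →ₜ* Circle, χ x ≠ 1 := by
  -- the `U y` and `t` lie in the bicommutant of the representation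
  set S : Set 𝔄 := Set.range U with hS
  have hstar : ∀ a ∈ S, star a ∈ S := by
    rintro _ ⟨y, rfl⟩
    exact ⟨y⁻¹, (hU y).symm⟩
  have hcomm : ∀ a ∈ S, ∀ b ∈ S, a * b = b * a := by
    rintro _ ⟨y, rfl⟩ _ ⟨z, rfl⟩
    rw [← map_mul, ← map_mul, mul_comm]
  have hmemL : ∀ y, U y ∈ StarSubalgebra.centralizer ℂ
      (StarSubalgebra.centralizer ℂ S : Set (𝔄)) := by
    intro y
    rw [StarSubalgebra.mem_centralizer_iff]
    intro R hR
    have hR' : star R ∈ StarSubalgebra.centralizer ℂ S := star_mem hR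
    rw [SetLike.mem_coe, StarSubalgebra.mem_centralizer_iff] at hR
    rw [StarSubalgebra.mem_centralizer_iff] at hR'
    exact ⟨((hR _ ⟨y, rfl⟩).1).symm, ((hR' _ ⟨y, rfl⟩).1).symm⟩
  have hmemT : t ∈ StarSubalgebra.centralizer ℂ
      (StarSubalgebra.centralizer ℂ S : Set (𝔄)) := by
    rw [StarSubalgebra.mem_centralizer_iff]
    intro R hR
    have hR' : star R ∈ StarSubalgebra.centralizer ℂ S := star_mem hR
    rw [SetLike.mem_coe, StarSubalgebra.mem_centralizer_iff] at hR
    rw [StarSubalgebra.mem_centralizer_iff] at hR'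
    exact ⟨(ht R fun y => (hR _ ⟨y, rfl⟩).1).symm,
      (ht _ fun y => (hR' _ ⟨y, rfl⟩).1).symm⟩
  set L : X → StarSubalgebra.centralizer ℂ
    (StarSubalgebra.centralizer ℂ S : Set (𝔄)) :=
    fun y => ⟨U y, hmemL y⟩ with hL
  set T : StarSubalgebra.centralizer ℂ
    (StarSubalgebra.centralizer ℂ S : Set (𝔄)) :=
    ⟨t, hmemT⟩ with hT
  have hLmul : ∀ y z, L (y * z) = L y * L z := fun y z => Subtype.ext (map_mul U y z)
  have hLone : L 1 = 1 := Subtype.ext (map_one U)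
  have hLstar : ∀ y, star (L y) = L y⁻¹ := fun y => Subtype.ext (hU y)
  -- `φ T ≠ 0` gives continuity of `φ ∘ L`, and `φ (L x) ≠ 1` nontriviality at `x`
  have hne : (L x - 1) * T ≠ 0 := by
    rw [sub_mul, one_mul, sub_ne_zero]
    intro h
    exact hx (congrArg Subtype.val h)
  obtain ⟨φ, hφc, hφ⟩ := exists_characterSpace_bicommutant_ne_zero S hstar hcomm _ hne
  rw [map_mul, map_sub, map_one] at hφ
  have hφT : φ T ≠ 0 := right_ne_zero_of_mul hφ
  have hφx : φ (L x) ≠ 1 := sub_ne_zero.1 (left_ne_zero_of_mul hφ)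
  have hcirc : ∀ y, φ (L y) ∈ Submonoid.unitSphere ℂ := by
    intro y
    have h : φ (L y) * (starRingEnd ℂ) (φ (L y)) = 1 := by
      rw [starRingEnd_apply, ← map_star, hLstar, ← map_mul, ← hLmul, mul_inv_cancel, hLone, map_one]
    rw [Complex.mul_conj, Complex.normSq_eq_norm_sq] at h
    have h' : ‖φ (L y)‖ ^ 2 = 1 := by exact_mod_cast h
    exact mem_sphere_zero_iff_norm.2 ((pow_eq_one_iff_of_nonneg (norm_nonneg _) two_ne_zero).1 h')
  have hcontφ : Continuous fun y => φ (L y) := by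
    have h1 : Continuous fun y => φ (L y * T) := by
      exact hφc.comp (Continuous.subtype_mk htc fun y => (L y * T).2)
    have h2 : (fun y => φ (L y)) = fun y => φ (L y * T) / φ T := by
      ext1 y; rw [map_mul, mul_div_cancel_right₀ _ hφT]
    rw [h2]
    exact h1.div_const _
  refine ⟨{ toFun := fun y => ⟨φ (L y), hcirc y⟩
            map_one' := Subtype.ext ((congrArg φ hLone).trans (map_one φ))
            map_mul' := fun y z => Subtype.ext ((congrArg φ (hLmul y z)).trans (map_mul φ _ _))
            continuous_toFun := Continuous.subtype_mk hcontφ _ }, fun h => hφx ?_⟩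
  exact congrArg Subtype.val h

section Translation

variable {X : Type*} [CommGroup X] [TopologicalSpace X] [IsTopologicalGroup X]
  [CompactSpace X] [T2Space X] [MeasurableSpace X] [BorelSpace X]
  (m : Measure X) [m.IsHaarMeasure] [m.Regular] [IsProbabilityMeasure m]

/-- Translation by `y`, `f ↦ f (y * ·)`, as an operator on `L²`. -/
noncomputable def translationOp (y : X) : Lp ℂ 2 m →L[ℂ] Lp ℂ 2 m :=
  (Lp.compMeasurePreservingₗᵢ ℂ (fun x => y * x)
    (measurePreserving_mul_left m y)).toContinuousLinearMap

theorem translationOp_coeFn (y : X) (f : Lp ℂ 2 m) :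
    translationOp m y f =ᵐ[m] fun x => f (y * x) :=
  Lp.coeFn_compMeasurePreserving f (measurePreserving_mul_left m y)

theorem norm_translationOp_apply (y : X) (f : Lp ℂ 2 m) : ‖translationOp m y f‖ = ‖f‖ :=
  Lp.norm_compMeasurePreserving f (measurePreserving_mul_left m y)

theorem translationOp_mul (x y : X) :
    translationOp m (x * y) = translationOp m x * translationOp m y := by
  ext1 f
  refine Lp.ext ?_
  have h1 := (measurePreserving_mul_left m x).quasiMeasurePreserving.ae
    (translationOp_coeFn m y f)
  filter_upwards [translationOp_coeFn m (x * y) f, translationOp_coeFn m x (translationOp m y f),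
    h1] with z hz1 hz2 hz3
  rw [hz1, mul_apply_eq_comp, hz2, hz3]
  congr 1
  rw [← mul_assoc, mul_comm x y]

theorem translationOp_one : translationOp m (1 : X) = 1 := by
  ext1 f
  refine Lp.ext ?_
  filter_upwards [translationOp_coeFn m 1 f] with z hz
  rw [hz, one_mul]; rfl

theorem continuous_translationOp_apply (f : Lp ℂ 2 m) :
    Continuous fun y : X => translationOp m y f := by
  have : Fact ((2 : ENNReal) ≠ ⊤) := ⟨by norm_num⟩
  have h : Continuous fun y : X => (DomMulAct.mk y) • f :=
    (DomMulAct.continuous_mk.smul continuous_const)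
  exact h

theorem star_translationOp (y : X) : star (translationOp m y) = translationOp m y⁻¹ := by
  rw [ContinuousLinearMap.star_eq_adjoint]
  symm
  rw [ContinuousLinearMap.eq_adjoint_iff]
  intro f g
  have h : g = translationOp m y⁻¹ (translationOp m y g) := by
    rw [← mul_apply_eq_comp, ← translationOp_mul, inv_mul_cancel, translationOp_one]
    rfl
  conv_lhs => rw [h]
  exact (Lp.compMeasurePreservingₗᵢ ℂ (fun x => y⁻¹ * x)
    (measurePreserving_mul_left m y⁻¹)).inner_map_map f (translationOp m y g)

theorem integrable_smul_translationOp (k : C(X, ℂ)) (f : Lp ℂ 2 m) :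
    Integrable (fun y => k y • translationOp m y f) m := by
  have h : Continuous (fun y => k y • translationOp m y f) :=
    k.continuous.smul (continuous_translationOp_apply m f)
  exact h.integrable_of_hasCompactSupport (HasCompactSupport.of_compactSpace _)

/-- The operator `f ↦ ∫ k(y) f(y ·) dy` on `L²`, averaging translations with weight `k`. -/
noncomputable def averageOp (k : C(X, ℂ)) : Lp ℂ 2 m →L[ℂ] Lp ℂ 2 m :=
  LinearMap.mkContinuous
    { toFun := fun f => ∫ y, k y • translationOp m y f ∂m
      map_add' := fun f g => by
        simp only [map_add, smul_add]
        exact integral_add (integrable_smul_translationOp m k f)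
          (integrable_smul_translationOp m k g)
      map_smul' := fun c f => by
        simp only [map_smul, RingHom.id_apply]
        rw [← integral_smul]
        congr 1; ext1 y
        rw [smul_comm] } ‖k‖ (fun f => by
      refine (norm_integral_le_of_norm_le_const (C := ‖k‖ * ‖f‖) ?_).trans ?_
      · refine Eventually.of_forall fun y => ?_
        rw [norm_smul, norm_translationOp_apply]
        gcongr
        exact k.norm_coe_le_norm y
      · simp)

theorem averageOp_apply (k : C(X, ℂ)) (f : Lp ℂ 2 m) :
    averageOp m k f = ∫ y, k y • translationOp m y f ∂m := rfl

theorem norm_averageOp_le (k : C(X, ℂ)) : ‖averageOp m k‖ ≤ ‖k‖ :=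
  LinearMap.mkContinuous_norm_le _ (norm_nonneg _) _

theorem averageOp_sub (k l : C(X, ℂ)) : averageOp m (k - l) = averageOp m k - averageOp m l := by
  ext1 f
  rw [sub_apply, averageOp_apply, averageOp_apply, averageOp_apply,
    ← integral_sub (integrable_smul_translationOp m k f) (integrable_smul_translationOp m l f)]
  simp only [ContinuousMap.sub_apply, sub_smul]

/-- The translate `y ↦ k (x⁻¹ * y)` of a continuous function. -/
noncomputable def translateFun (k : C(X, ℂ)) (x : X) : C(X, ℂ) :=
  ⟨fun y => k (x⁻¹ * y), by fun_prop⟩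

theorem continuous_translateFun (k : C(X, ℂ)) : Continuous (translateFun k) := by
  have h : Continuous (fun p : X × X => k (p.1⁻¹ * p.2)) := by fun_prop
  exact (ContinuousMap.curry ⟨_, h⟩).continuous

theorem translationOp_mul_averageOp (x : X) (k : C(X, ℂ)) :
    translationOp m x * averageOp m k = averageOp m (translateFun k x) := by
  ext1 f
  rw [mul_apply_eq_comp, averageOp_apply, averageOp_apply,
    ← ContinuousLinearMap.integral_comp_comm _ (integrable_smul_translationOp m k f)]
  rw [← integral_mul_left_eq_self (μ := m) (fun y => translateFun k x y • translationOp m y f) x]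
  congr 1; ext1 y
  simp [translateFun, translationOp_mul]

theorem continuous_translationOp_mul_averageOp (k : C(X, ℂ)) :
    Continuous fun x => translationOp m x * averageOp m k := by
  simp only [translationOp_mul_averageOp]
  have hL : LipschitzWith 1 (averageOp m) := LipschitzWith.of_dist_le_mul fun k l => by
    rw [dist_eq_norm, dist_eq_norm, ← averageOp_sub, NNReal.coe_one, one_mul]
    exact norm_averageOp_le m _
  exact hL.continuous.comp (continuous_translateFun k)

/-- An operator which commutes with all translations commutes with their averages. -/
theorem averageOp_commute (k : C(X, ℂ)) (R : Lp ℂ 2 m →L[ℂ] Lp ℂ 2 m)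
    (hR : ∀ y, translationOp m y * R = R * translationOp m y) :
    averageOp m k * R = R * averageOp m k := by
  ext1 f
  rw [mul_apply_eq_comp, mul_apply_eq_comp, averageOp_apply,
    averageOp_apply, ← ContinuousLinearMap.integral_comp_comm _
      (integrable_smul_translationOp m k f)]
  congr 1; ext1 y
  rw [map_smul]
  congr 1
  exact congrArg (fun T => T f) (hR y)

/-- Averages with weights concentrated near `1` approximate the identity strongly. -/
theorem exists_averageOp_sub_le (f : Lp ℂ 2 m) {ε : ℝ} (hε : 0 < ε) :
    ∃ k : C(X, ℂ), ‖averageOp m k f - f‖ ≤ ε := by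
  have hcont := continuous_translationOp_apply m f
  have hU : IsOpen {y : X | ‖translationOp m y f - f‖ < ε} :=
    isOpen_lt (by fun_prop) continuous_const
  have h1 : (1 : X) ∈ {y : X | ‖translationOp m y f - f‖ < ε} := by
    simp only [Set.mem_ofPred_eq]; rw [translationOp_one]; simpa using hε
  obtain ⟨g, hg1, hg0, hg01⟩ := exists_continuous_zero_one_of_isClosed
    (s := {y : X | ‖translationOp m y f - f‖ < ε}ᶜ) (t := {1}) hU.isClosed_compl
    isClosed_singleton (by simpa using h1)
  have hgint : Integrable g m :=
    g.continuous.integrable_of_hasCompactSupport (HasCompactSupport.of_compactSpace _)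
  have hpos : 0 < ∫ y, g y ∂m := by
    refine g.continuous.integral_pos_of_hasCompactSupport_nonneg_nonzero
      (HasCompactSupport.of_compactSpace _) (fun y => (hg01 y).1) (x := 1) ?_
    rw [hg0 (Set.mem_singleton 1)]; simp
  -- the weight is `g / ∫ g`, with `g` a bump supported where `translationOp m y f` is close to `f`
  set c := ∫ y, g y ∂m with hc
  refine ⟨⟨fun y => ((c⁻¹ * g y : ℝ) : ℂ), by fun_prop⟩, ?_⟩
  have hone : ∫ y, (((c⁻¹ * g y : ℝ) : ℂ)) ∂m = 1 := by
    rw [integral_complex_ofReal, integral_const_mul, ← hc, inv_mul_cancel₀ hpos.ne']; simp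
  have hf : f = ∫ y, (((c⁻¹ * g y : ℝ) : ℂ)) • f ∂m := by
    rw [integral_smul_const, hone, one_smul]
  have hi1 := integrable_smul_translationOp m ⟨fun y => ((c⁻¹ * g y : ℝ) : ℂ), by fun_prop⟩ f
  have hi2 : Integrable (fun y => (((c⁻¹ * g y : ℝ) : ℂ)) • f) m :=
    ((hgint.const_mul c⁻¹).ofReal).smul_const f
  rw [averageOp_apply]
  conv_lhs => rw [hf, ← hf]
  nth_rewrite 2 [hf]
  rw [← integral_sub hi1 hi2]
  have hb : ∀ y, ‖(((c⁻¹ * g y : ℝ) : ℂ)) • translationOp m y f - (((c⁻¹ * g y : ℝ) : ℂ)) • f‖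
      ≤ (c⁻¹ * g y) * ε := by
    intro y
    have h0 : 0 ≤ c⁻¹ * g y := mul_nonneg (inv_nonneg.2 hpos.le) (hg01 y).1
    rw [← smul_sub, norm_smul, Complex.norm_real, Real.norm_of_nonneg h0]
    by_cases hy : ‖translationOp m y f - f‖ < ε
    · gcongr
    · have : g y = 0 := hg1 hy
      simp [this]
  refine (norm_integral_le_of_norm_le ((hgint.const_mul c⁻¹).mul_const ε)
    (Eventually.of_forall hb)).trans ?_
  rw [integral_mul_const, integral_const_mul, ← hc, inv_mul_cancel₀ hpos.ne', one_mul]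

/-- A translation by a nontrivial element moves some function in `L²`. -/
theorem translationOp_ne_one {x : X} (hx : x ≠ 1) : ∃ f, translationOp m x f ≠ f := by
  obtain ⟨g, hg1, hg0, hg01⟩ := exists_continuous_zero_one_of_isClosed
    (s := {x}) (t := {(1 : X)}) isClosed_singleton isClosed_singleton (by simpa using hx)
  have hcont : Continuous fun y => (g y : ℂ) := by fun_prop
  have hmem : MemLp (fun y => (g y : ℂ)) 2 m :=
    hcont.memLp_of_hasCompactSupport (HasCompactSupport.of_compactSpace _)
  refine ⟨hmem.toLp _, fun h => ?_⟩
  have hae : (fun y => (g (x * y) : ℂ)) =ᵐ[m] fun y => (g y : ℂ) := by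
    have h1 := translationOp_coeFn m x (hmem.toLp _)
    rw [h] at h1
    have h2 := (measurePreserving_mul_left m x).quasiMeasurePreserving.ae hmem.coeFn_toLp
    filter_upwards [h1, hmem.coeFn_toLp, h2] with z hz1 hz2 hz3
    rw [← hz3, ← hz1, hz2]
  have heq := Continuous.ae_eq_iff_eq m (by fun_prop) hcont |>.1 hae
  have := congrFun heq 1
  simp only [mul_one] at this
  rw [hg1 (Set.mem_singleton x), hg0 (Set.mem_singleton 1)] at this
  simp at this

include m in
/-- Continuous characters of a compact abelian group separate points. -/
theorem exists_character_ne_one {x : X} (hx : x ≠ 1) : ∃ χ : X →ₜ* Circle, χ x ≠ 1 := by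
  obtain ⟨k, hk⟩ : ∃ k, translationOp m x * averageOp m k ≠ averageOp m k := by
    by_contra! hcon
    obtain ⟨f, hf⟩ := translationOp_ne_one m hx
    apply hf
    rw [← sub_eq_zero, ← norm_eq_zero]
    refine le_antisymm (le_of_forall_pos_le_add fun ε hε => ?_) (norm_nonneg _)
    obtain ⟨k, hk⟩ := exists_averageOp_sub_le m f (half_pos hε)
    have h1 : translationOp m x (averageOp m k f) = averageOp m k f :=
      congrArg (fun T => T f) (hcon k)
    have h2 : translationOp m x f - f
        = translationOp m x (f - averageOp m k f) + (averageOp m k f - f) := by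
      rw [map_sub, h1]; abel
    calc ‖translationOp m x f - f‖ ≤ ‖translationOp m x (f - averageOp m k f)‖
          + ‖averageOp m k f - f‖ := by rw [h2]; exact norm_add_le _ _
      _ ≤ ε / 2 + ε / 2 := by
          rw [norm_translationOp_apply, norm_sub_rev]; gcongr
      _ = 0 + ε := by ring
  exact exists_character_of_starRep
    { toFun := translationOp m, map_one' := translationOp_one m, map_mul' := translationOp_mul m }
    (star_translationOp m) (averageOp m k) (averageOp_commute m k)
    (continuous_translationOp_mul_averageOp m k) hk

end Translation

/-! ### Trigonometric polynomials and Pontryagin duality -/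

/-- Stone–Weierstrass for a star-closed monoid of functions: its span is already an algebra. -/
theorem submodule_eq_top_of_separatesPoints {Y : Type*} [TopologicalSpace Y] [CompactSpace Y]
    (P : Submodule ℂ C(Y, ℂ)) (hP : IsClosed (P : Set C(Y, ℂ))) (M : Submonoid C(Y, ℂ))
    (hstar : ∀ f ∈ M, star f ∈ M) (hsep : ∀ x y : Y, x ≠ y → ∃ f ∈ M, f x ≠ f y)
    (hMP : ∀ f ∈ M, f ∈ P) : P = ⊤ := by
  have hspan : (Algebra.adjoin ℂ (M : Set C(Y, ℂ))).toSubmodule = Submodule.span ℂ (M : Set _) := by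
    rw [Algebra.adjoin_eq_span, Submonoid.closure_eq]
  let A : StarSubalgebra ℂ C(Y, ℂ) :=
    { Algebra.adjoin ℂ (M : Set C(Y, ℂ)) with
      star_mem' := by
        intro a ha
        change a ∈ (Algebra.adjoin ℂ (M : Set C(Y, ℂ))).toSubmodule at ha
        change star a ∈ (Algebra.adjoin ℂ (M : Set C(Y, ℂ))).toSubmodule
        rw [hspan] at ha ⊢
        induction ha using Submodule.span_induction with
        | mem x hx => exact Submodule.subset_span (hstar x hx)
        | zero => simp
        | add x y _ _ hx hy => rw [star_add]; exact add_mem hx hy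
        | smul c x _ hx => rw [star_smul]; exact Submodule.smul_mem _ _ hx }
  have hA : A.SeparatesPoints := by
    intro x y hxy
    obtain ⟨f, hf, hfxy⟩ := hsep x y hxy
    exact ⟨f, ⟨f, Algebra.subset_adjoin hf, rfl⟩, hfxy⟩
  have hdense := ContinuousMap.starSubalgebra_topologicalClosure_eq_top_of_separatesPoints A hA
  rw [eq_top_iff]
  intro f _
  have hf : f ∈ A.topologicalClosure := by rw [hdense]; trivial
  have hf' : f ∈ closure (A : Set C(Y, ℂ)) := hf
  refine closure_minimal ?_ hP hf'
  intro g hg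
  have hg' : g ∈ (Algebra.adjoin ℂ (M : Set C(Y, ℂ))).toSubmodule := hg
  rw [hspan] at hg'
  exact Submodule.span_le.2 (fun f hf => hMP f hf) hg'

section Characters

variable {X : Type*} [CommGroup X] [TopologicalSpace X] [IsTopologicalGroup X]
  [CompactSpace X] [T2Space X] [MeasurableSpace X] [BorelSpace X]
  (m : Measure X) [m.IsHaarMeasure] [m.Regular] [IsProbabilityMeasure m]

/-- A character as a complex-valued continuous function. -/
noncomputable def characterMap : (X →ₜ* Circle) →* C(X, ℂ) where
  toFun χ := ⟨fun x => (χ x : ℂ), by fun_prop⟩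
  map_one' := by ext x; simp
  map_mul' χ ψ := by ext x; simp

theorem characterMap_apply (χ : X →ₜ* Circle) (x : X) : characterMap χ x = (χ x : ℂ) := rfl

include m in
/-- The trigonometric polynomials are uniformly dense in the continuous functions. -/
theorem submodule_eq_top_of_characterMap_mem (P : Submodule ℂ C(X, ℂ))
    (hP : IsClosed (P : Set C(X, ℂ))) (h : ∀ χ : X →ₜ* Circle, characterMap χ ∈ P) : P = ⊤ := by
  refine submodule_eq_top_of_separatesPoints P hP (MonoidHom.mrange characterMap) ?_ ?_ ?_
  · rintro _ ⟨χ, rfl⟩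
    refine ⟨χ⁻¹, ?_⟩
    ext x
    exact Circle.coe_inv_eq_conj (χ x)
  · intro x y hxy
    obtain ⟨χ, hχ⟩ := exists_character_ne_one m (x := x / y) (by rwa [Ne, div_eq_one])
    refine ⟨characterMap χ, ⟨χ, rfl⟩, fun h => hχ ?_⟩
    rw [map_div, div_eq_one]
    exact Circle.ext h
  · rintro _ ⟨χ, rfl⟩
    exact h χ

theorem integral_character_eq_zero (χ : X →ₜ* Circle) (hχ : χ ≠ 1) :
    ∫ x, (χ x : ℂ) ∂m = 0 := by
  obtain ⟨y, hy⟩ : ∃ y, χ y ≠ 1 := by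
    by_contra! h
    exact hχ (ContinuousMonoidHom.ext h)
  have h1 := integral_mul_left_eq_self (μ := m) (fun x => (χ x : ℂ)) y
  simp only [map_mul, Circle.coe_mul] at h1
  rw [integral_const_mul] at h1
  have h2 : ((χ y : ℂ) - 1) * ∫ x, (χ x : ℂ) ∂m = 0 := by rw [sub_mul, h1, one_mul, sub_self]
  rcases mul_eq_zero.1 h2 with h | h
  · exact absurd (Circle.ext (by simpa [sub_eq_zero] using h)) hy
  · exact h

theorem integrable_continuousMap_comp {Y : Type*} [TopologicalSpace Y] (g : C(X, Y))
    (h : C(Y, ℂ)) : Integrable (fun x => h (g x)) m :=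
  (h.comp g).continuous.integrable_of_hasCompactSupport (HasCompactSupport.of_compactSpace _)

/-- The integral of `h` against the image of `m` under `g`, as a functional of `h`. -/
noncomputable def integralCompCLM {Y : Type*} [TopologicalSpace Y] [CompactSpace Y] (g : C(X, Y)) :
    C(Y, ℂ) →L[ℂ] ℂ :=
  LinearMap.mkContinuous
    { toFun := fun h => ∫ x, h (g x) ∂m
      map_add' := fun h k =>
        integral_add (integrable_continuousMap_comp m g h) (integrable_continuousMap_comp m g k)
      map_smul' := fun c h => integral_const_mul c _ } 1 (fun h => by
    refine (norm_integral_le_of_norm_le_const (C := ‖h‖) ?_).trans ?_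
    · exact Eventually.of_forall fun x => h.norm_coe_le_norm _
    · simp)

include m in
/-- The surjectivity half of Pontryagin duality: every homomorphism from the character group to
the circle is evaluation at a point. Otherwise the evaluations form a proper closed subgroup of
the compact group of all homomorphisms, and a continuous function separating it from one of its
cosets has distinct Haar averages over the two; but the two averages agree on trigonometric
polynomials. -/
theorem exists_eval_eq (y₀ : (X →ₜ* Circle) →* Circle) : ∃ x : X, ∀ χ, χ x = y₀ χ := by
  -- the space of all homomorphisms, in the product topology; multiplicativity suffices
  let Y := {y : (X →ₜ* Circle) → Circle // ∀ χ ψ, y (χ * ψ) = y χ * y ψ}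
  have hclosed : IsClosed {y : (X →ₜ* Circle) → Circle | ∀ χ ψ, y (χ * ψ) = y χ * y ψ} := by
    simp only [Set.ofPred_forall]
    refine isClosed_iInter fun χ => isClosed_iInter fun ψ => isClosed_eq (by fun_prop) (by fun_prop)
  have : CompactSpace Y := isCompact_iff_compactSpace.1 hclosed.isCompact
  let e : C(X, Y) := ⟨fun x => ⟨fun χ => χ x, fun χ ψ => rfl⟩,
    Continuous.subtype_mk (continuous_pi fun χ => χ.continuous_toFun) _⟩
  -- the coset of `y₀`
  let e' : C(X, Y) := ⟨fun x => ⟨fun χ => y₀ χ * χ x, fun χ ψ => by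
      change y₀ (χ * ψ) * (χ x * ψ x) = _
      rw [map_mul]; exact mul_mul_mul_comm _ _ _ _⟩,
    Continuous.subtype_mk (continuous_pi fun χ => continuous_const.mul χ.continuous_toFun) _⟩
  by_contra! hcon
  have hdisj : Disjoint (Set.range e) (Set.range e') := by
    rw [Set.disjoint_left]
    rintro _ ⟨x, rfl⟩ ⟨x', hx'⟩
    obtain ⟨χ, hχ⟩ := hcon (x / x')
    apply hχ
    have h1 : y₀ χ * χ x' = χ x := congrFun (congrArg Subtype.val hx') χ
    rw [map_div, ← h1, mul_div_cancel_right]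
  obtain ⟨f, hf0, hf1, -⟩ := exists_continuous_zero_one_of_isClosed
    (isCompact_range e.continuous).isClosed (isCompact_range e'.continuous).isClosed hdisj
  -- functions with equal averages over the subgroup and its coset
  let P : Submodule ℂ C(Y, ℂ) :=
    LinearMap.ker ((integralCompCLM m e - integralCompCLM m e').toLinearMap)
  have hPc : IsClosed (P : Set C(Y, ℂ)) :=
    ContinuousLinearMap.isClosed_ker (integralCompCLM m e - integralCompCLM m e')
  have hmem : ∀ h : C(Y, ℂ), h ∈ P ↔ ∫ x, h (e x) ∂m = ∫ x, h (e' x) ∂m := by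
    intro h
    rw [LinearMap.mem_ker]
    exact sub_eq_zero
  let M : Submonoid C(Y, ℂ) :=
    { carrier := {h | ∃ χ : X →ₜ* Circle, ∀ y : Y, h y = (y.1 χ : ℂ)}
      one_mem' := ⟨1, fun y => by
        have h := y.2 1 1
        rw [one_mul] at h
        rw [left_eq_mul.1 h]
        simp⟩
      mul_mem' := by
        rintro h k ⟨χ, hχ⟩ ⟨ψ, hψ⟩
        exact ⟨χ * ψ, fun y => by rw [y.2, ContinuousMap.mul_apply, hχ, hψ, Circle.coe_mul]⟩ }
  have hinv : ∀ (y : Y) χ, y.1 χ⁻¹ = (y.1 χ)⁻¹ := by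
    intro y χ
    have h1 := y.2 1 1
    rw [one_mul] at h1
    have h := y.2 χ⁻¹ χ
    rw [inv_mul_cancel, left_eq_mul.1 h1] at h
    exact eq_inv_of_mul_eq_one_left h.symm
  have htop : P = ⊤ := by
    refine submodule_eq_top_of_separatesPoints P hPc M ?_ ?_ ?_
    · rintro h ⟨χ, hχ⟩
      refine ⟨χ⁻¹, fun y => ?_⟩
      rw [hinv, ContinuousMap.star_apply, hχ, Circle.coe_inv_eq_conj]
      rfl
    · intro y z hyz
      obtain ⟨χ, hχ⟩ : ∃ χ, y.1 χ ≠ z.1 χ := by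
        by_contra! h
        exact hyz (Subtype.ext (funext h))
      refine ⟨⟨fun y => (y.1 χ : ℂ), ?_⟩, ⟨χ, fun y => rfl⟩, fun h => hχ (Circle.ext h)⟩
      exact continuous_subtype_val.comp ((continuous_apply χ).comp continuous_subtype_val)
    · rintro h ⟨χ, hχ⟩
      rw [hmem]
      simp only [hχ]
      change ∫ x, (χ x : ℂ) ∂m = ∫ x, ((y₀ χ * χ x : Circle) : ℂ) ∂m
      simp only [Circle.coe_mul]
      rw [integral_const_mul]
      by_cases hχ1 : χ = 1
      · simp [hχ1]
      · rw [integral_character_eq_zero m χ hχ1, mul_zero]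
  have hfP : (⟨fun y => (f y : ℂ), by fun_prop⟩ : C(Y, ℂ)) ∈ P := by rw [htop]; trivial
  rw [hmem] at hfP
  have h0 : ∀ x, f (e x) = 0 := fun x => hf0 ⟨x, rfl⟩
  have h1 : ∀ x, f (e' x) = 1 := fun x => hf1 ⟨x, rfl⟩
  simp [h0, h1] at hfP

end Characters

/-! ### Mixing in terms of characters -/

theorem norm_prod_sub_prod_le_sum {ι R : Type*} [NormedField R] (s : Finset ι)
    (a b : ι → R) (ha : ∀ i ∈ s, ‖a i‖ ≤ 1) (hb : ∀ i ∈ s, ‖b i‖ ≤ 1) :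
    ‖∏ i ∈ s, a i - ∏ i ∈ s, b i‖ ≤ ∑ i ∈ s, ‖a i - b i‖ := by
  classical
  induction s using Finset.induction_on with
  | empty => simp
  | insert i s hi ih =>
    rw [Finset.prod_insert hi, Finset.prod_insert hi, Finset.sum_insert hi]
    have h1 : ‖∏ j ∈ s, a j‖ ≤ 1 :=
      (Finset.norm_prod_le s a).trans (Finset.prod_le_one (fun _ _ => norm_nonneg _)
        fun j hj => ha j (Finset.mem_insert_of_mem hj))
    have h2 := ih (fun j hj => ha j (Finset.mem_insert_of_mem hj))
      (fun j hj => hb j (Finset.mem_insert_of_mem hj))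
    have h3 : a i * ∏ j ∈ s, a j - b i * ∏ j ∈ s, b j
        = (a i - b i) * ∏ j ∈ s, a j + b i * (∏ j ∈ s, a j - ∏ j ∈ s, b j) := by ring
    rw [h3]
    refine (norm_add_le _ _).trans (add_le_add ?_ ?_)
    · exact (norm_mul_le _ _).trans (mul_le_of_le_one_right (norm_nonneg _) h1)
    · exact (norm_mul_le _ _).trans ((mul_le_of_le_one_left (norm_nonneg _)
        (hb i (Finset.mem_insert_self _ _))).trans h2)

section Mixing

variable {X : Type*} [CommGroup X] [TopologicalSpace X]

/-- The endomorphism `χ ↦ χ ∘ γ` of the character group dual to `γ`. -/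
noncomputable def dualHom (γ : X →ₜ* X) : Monoid.End (X →ₜ* Circle) where
  toFun χ := χ.comp γ
  map_one' := rfl
  map_mul' _ _ := rfl

theorem dualHom_pow_apply (γ : X →ₜ* X) (n : ℕ) (χ : X →ₜ* Circle) (x : X) :
    ((dualHom γ) ^ n) χ x = χ ((⇑γ)^[n] x) := by
  induction n generalizing χ x with
  | zero => rfl
  | succ n ih =>
    rw [pow_succ, Monoid.End.coe_mul, Function.comp_apply, ih, Function.iterate_succ_apply']
    rfl

theorem dualHom_injective {γ : X →ₜ* X} (hγ : Function.Surjective γ) :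
    Function.Injective (dualHom γ) := by
  intro χ ψ h
  ext x
  obtain ⟨y, rfl⟩ := hγ x
  exact congrArg Subtype.val (DFunLike.congr_fun h y)

/-- The `n`-th iterate of `γ` as a continuous map. -/
def iterateMap (γ : X →ₜ* X) (n : ℕ) : C(X, X) := ⟨(⇑γ)^[n], γ.continuous_toFun.iterate n⟩

theorem prod_dualHom_pow_apply (E : Finset (X →ₜ* X)) (n : ℕ) (χ : (X →ₜ* X) → (X →ₜ* Circle))
    (x : X) : (∏ γ ∈ E, ((dualHom γ) ^ n) (χ γ)) x = ∏ γ ∈ E, χ γ ((⇑γ)^[n] x) := by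
  classical
  induction E using Finset.induction_on with
  | empty => rfl
  | insert γ E hγ ih =>
    rw [Finset.prod_insert hγ, Finset.prod_insert hγ, ← ih, ← dualHom_pow_apply]
    rfl

variable [IsTopologicalGroup X] [CompactSpace X] [T2Space X] [MeasurableSpace X] [BorelSpace X]
  (m : Measure X) [m.IsHaarMeasure] [m.Regular] [IsProbabilityMeasure m]

/-- In a mixing set a nontrivial tuple of characters satisfies a relation `∏ χ γ ∘ γⁿ = 1` only
finitely often. Otherwise the sets where `χ γ` is close to `1`, for all `γ` but one, and far
from `1`, for the remaining one, would have disjoint preimages at infinitely many times. -/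
theorem IsMixingSet.eventually_prod_ne_one {E : Finset (X →ₜ* X)} (hE : IsMixingSet m E)
    (χ : (X →ₜ* X) → (X →ₜ* Circle)) (hχ : ∃ γ ∈ E, χ γ ≠ 1) :
    ∀ᶠ n in atTop, ∏ γ ∈ E, ((dualHom γ) ^ n) (χ γ) ≠ 1 := by
  classical
  obtain ⟨γ₀, hγ₀, hne⟩ := hχ
  obtain ⟨x₀, hx₀⟩ : ∃ x, χ γ₀ x ≠ 1 := by
    by_contra! h
    exact hne (ContinuousMonoidHom.ext h)
  set δ : ℝ := ‖(χ γ₀ x₀ : ℂ) - 1‖ with hδ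
  have hδpos : 0 < δ := norm_pos_iff.2 (sub_ne_zero.2 fun h => hx₀ (Circle.ext (by simpa using h)))
  set ε : ℝ := δ / (2 * E.card) with hε
  have hcard : (0 : ℝ) < E.card := by
    have := hE.1
    exact_mod_cast (by omega : 0 < E.card)
  have hεpos : 0 < ε := by positivity
  -- `ε` is so small that factors within `ε` of `1` have a product within `δ / 2` of `1`
  set B : (X →ₜ* X) → Set X := fun γ =>
    if γ = γ₀ then {x | δ / 2 < ‖(χ γ x : ℂ) - 1‖} else {x | ‖(χ γ x : ℂ) - 1‖ < ε} with hB
  have hopen : ∀ γ, IsOpen (B γ) := by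
    intro γ
    simp only [hB]
    split_ifs
    · exact isOpen_lt continuous_const (by fun_prop)
    · exact isOpen_lt (by fun_prop) continuous_const
  have hnonempty : ∀ γ, (B γ).Nonempty := by
    intro γ
    simp only [hB]
    split_ifs with h
    · subst h
      exact ⟨x₀, by simp only [Set.mem_ofPred_eq, ← hδ]; linarith⟩
    · exact ⟨1, by simpa using hεpos⟩
  have hlim := hE.2 B (fun γ _ => (hopen γ).measurableSet.nullMeasurableSet)
  have hpos : 0 < ∏ γ ∈ E, m (B γ) := by
    rw [pos_iff_ne_zero, Finset.prod_ne_zero_iff]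
    intro γ _
    exact ((hopen γ).measure_pos m (hnonempty γ)).ne'
  filter_upwards [hlim.eventually (lt_mem_nhds hpos)] with n hn hprod
  refine hn.ne' ?_
  suffices h : (⋂ γ ∈ E, (⇑γ)^[n] ⁻¹' B γ) = ∅ by rw [h, measure_empty]
  rw [Set.eq_empty_iff_forall_notMem]
  intro x hx
  rw [Set.mem_iInter₂] at hx
  have h1 : ∏ γ ∈ E, χ γ ((⇑γ)^[n] x) = 1 := by
    rw [← prod_dualHom_pow_apply, hprod]; rfl
  rw [← Finset.mul_prod_erase E _ hγ₀] at h1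
  have h2 : δ / 2 < ‖(χ γ₀ ((⇑γ₀)^[n] x) : ℂ) - 1‖ := by
    have := hx γ₀ hγ₀
    simpa [hB] using this
  set z := χ γ₀ ((⇑γ₀)^[n] x) with hz
  set w := ∏ γ ∈ E.erase γ₀, χ γ ((⇑γ)^[n] x) with hw
  have h3 : ‖(z : ℂ) - 1‖ = ‖(w : ℂ) - 1‖ := by
    have : (z : ℂ) - 1 = z * (1 - w) := by
      rw [mul_sub, ← Circle.coe_mul, h1, Circle.coe_one, mul_one]
    rw [this, norm_mul, Circle.norm_coe, one_mul, norm_sub_rev]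
  have h4 : ‖(w : ℂ) - 1‖ ≤ ∑ γ ∈ E.erase γ₀, ‖(χ γ ((⇑γ)^[n] x) : ℂ) - 1‖ := by
    have := norm_prod_sub_prod_le_sum (E.erase γ₀) (fun γ => (χ γ ((⇑γ)^[n] x) : ℂ))
      (fun _ => 1) (fun γ _ => (Circle.norm_coe _).le) (fun _ _ => norm_one.le)
    rw [Finset.prod_const_one] at this
    rwa [← show (w : ℂ) = ∏ γ ∈ E.erase γ₀, (χ γ ((⇑γ)^[n] x) : ℂ) from
      map_prod Circle.coeHom _ _] at this
  have h5 : ∑ γ ∈ E.erase γ₀, ‖(χ γ ((⇑γ)^[n] x) : ℂ) - 1‖ ≤ ∑ γ ∈ E.erase γ₀, ε := by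
    refine Finset.sum_le_sum fun γ hγ => ?_
    have := hx γ (Finset.mem_of_mem_erase hγ)
    simp only [hB, if_neg (Finset.ne_of_mem_erase hγ)] at this
    exact le_of_lt this
  have h6 : ∑ γ ∈ E.erase γ₀, ε ≤ E.card * ε := by
    rw [Finset.sum_const, nsmul_eq_mul]
    gcongr
    exact Finset.erase_subset _ _
  have h7 : E.card * ε = δ / 2 := by
    rw [hε]; field_simp
  linarith

/-- The set where a uniformly bounded sequence of functionals converges to zero is closed. -/
theorem isClosed_setOf_tendsto_zero {V : Type*} [NormedAddCommGroup V] [NormedSpace ℂ V]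
    (Λ : ℕ → V →ₗ[ℂ] ℂ) (C : ℝ) (hΛ : ∀ n v, ‖Λ n v‖ ≤ C * ‖v‖) :
    IsClosed {v | Tendsto (fun n => Λ n v) atTop (𝓝 0)} := by
  rw [← closure_subset_iff_isClosed]
  intro v hv
  rw [Set.mem_ofPred_eq, Metric.tendsto_atTop]
  intro ε hε
  have hC : 0 ≤ |C| := abs_nonneg C
  obtain ⟨w, hw, hvw⟩ := Metric.mem_closure_iff.1 hv (ε / (2 * (|C| + 1))) (by positivity)
  obtain ⟨N, hN⟩ := Metric.tendsto_atTop.1 hw (ε / 2) (half_pos hε)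
  refine ⟨N, fun n hn => ?_⟩
  have h1 := hN n hn
  rw [dist_zero_right] at h1 ⊢
  have h2 : ‖Λ n (v - w)‖ ≤ ε / 2 := by
    refine (hΛ n _).trans ?_
    rw [← dist_eq_norm]
    calc C * dist v w ≤ (|C| + 1) * (ε / (2 * (|C| + 1))) := by
          gcongr
          linarith [le_abs_self C]
      _ = ε / 2 := by field_simp
  calc ‖Λ n v‖ = ‖Λ n (v - w) + Λ n w‖ := by rw [← map_add, sub_add_cancel]
    _ ≤ ‖Λ n (v - w)‖ + ‖Λ n w‖ := norm_add_le _ _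
    _ < ε := by linarith

/-- The Haar integral as a functional on continuous functions. -/
noncomputable abbrev haarFunctional : C(X, ℂ) →L[ℂ] ℂ := integralCompCLM m (ContinuousMap.id X)

theorem norm_haarFunctional_apply_le (f : C(X, ℂ)) : ‖haarFunctional m f‖ ≤ ‖f‖ := by
  refine (norm_integral_le_of_norm_le_const (μ := m) (C := ‖f‖)
    (Eventually.of_forall fun x => f.norm_coe_le_norm x)).trans ?_
  simp

theorem haarFunctional_characterMap [DecidableEq (X →ₜ* Circle)] (χ : X →ₜ* Circle) :
    haarFunctional m (characterMap χ) = if χ = 1 then 1 else 0 := by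
  split_ifs with h
  · subst h
    change ∫ x, characterMap 1 x ∂m = 1
    simp
  · exact integral_character_eq_zero m χ h

/-- If relations between characters occur only finitely often, correlations of continuous
functions converge to the product of the integrals. One function after the other is allowed to
vary from the characters to all continuous functions. -/
theorem tendsto_haarFunctional_prod (F : Finset (X →ₜ* X))
    (h : ∀ χ : (X →ₜ* X) → (X →ₜ* Circle), (∃ γ ∈ F, χ γ ≠ 1) →
      ∀ᶠ n in atTop, ∏ γ ∈ F, ((dualHom γ) ^ n) (χ γ) ≠ 1) (f : (X →ₜ* X) → C(X, ℂ)) :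
    Tendsto (fun n : ℕ => haarFunctional m (∏ γ ∈ F, (f γ).comp (iterateMap γ n))) atTop
      (𝓝 (∏ γ ∈ F, haarFunctional m (f γ))) := by
  classical
  -- the functions with index outside `S` are characters
  suffices H : ∀ S : Finset (X →ₜ* X), S ⊆ F → ∀ f : (X →ₜ* X) → C(X, ℂ),
      (∀ γ ∈ F, γ ∉ S → ∃ χ, characterMap χ = f γ) →
      Tendsto (fun n : ℕ => haarFunctional m (∏ γ ∈ F, (f γ).comp (iterateMap γ n))) atTop
      (𝓝 (∏ γ ∈ F, haarFunctional m (f γ))) from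
    H F subset_rfl f fun γ hγ hγ' => absurd hγ hγ'
  intro S
  induction S using Finset.induction_on with
  | empty =>
    intro _ f hf
    choose! χ hχ using fun γ (hγ : γ ∈ F) => hf γ hγ (by simp)
    have h1 : ∀ n, ∏ γ ∈ F, (f γ).comp (iterateMap γ n)
        = characterMap (∏ γ ∈ F, ((dualHom γ) ^ n) (χ γ)) := by
      intro n
      rw [map_prod]
      refine Finset.prod_congr rfl fun γ hγ => ?_
      rw [← hχ γ hγ]
      ext x
      rw [characterMap_apply, dualHom_pow_apply]
      rfl
    have h2 : ∏ γ ∈ F, haarFunctional m (f γ)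
        = ∏ γ ∈ F, haarFunctional m (characterMap (χ γ)) :=
      Finset.prod_congr rfl fun γ hγ => by rw [hχ γ hγ]
    rw [h2]
    simp only [h1, haarFunctional_characterMap]
    by_cases hex : ∃ γ ∈ F, χ γ ≠ 1
    · obtain ⟨γ, hγ, hne⟩ := hex
      rw [Finset.prod_eq_zero hγ (if_neg hne)]
      refine tendsto_const_nhds.congr' ?_
      filter_upwards [h χ ⟨γ, hγ, hne⟩] with n hn
      rw [if_neg hn]
    · push Not at hex
      rw [Finset.prod_eq_one fun γ hγ => if_pos (hex γ hγ)]
      refine tendsto_const_nhds.congr fun n => ?_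
      rw [if_pos]
      exact Finset.prod_eq_one fun γ hγ => by rw [hex γ hγ, map_one]
  | insert γ₀ S hγ₀ ih =>
    intro hS f hf
    have hmem : γ₀ ∈ F := hS (Finset.mem_insert_self _ _)
    set R : ℕ → C(X, ℂ) := fun n => ∏ γ ∈ F.erase γ₀, (f γ).comp (iterateMap γ n) with hR
    set c : ℂ := ∏ γ ∈ F.erase γ₀, haarFunctional m (f γ) with hc
    let Λ : ℕ → C(X, ℂ) →ₗ[ℂ] ℂ := fun n =>
      (haarFunctional m).toLinearMap ∘ₗ LinearMap.mulRight ℂ (R n) ∘ₗ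
        (ContinuousMap.compRightAlgHom ℂ ℂ (iterateMap γ₀ n)).toLinearMap
        - c • (haarFunctional m).toLinearMap
    have hΛ : ∀ n g, Λ n g
        = haarFunctional m (g.comp (iterateMap γ₀ n) * R n) - c * haarFunctional m g :=
      fun n g => rfl
    have hcomp : ∀ (g : C(X, ℂ)) γ n, ‖g.comp (iterateMap γ n)‖ ≤ ‖g‖ := fun g γ n =>
      (ContinuousMap.norm_le _ (norm_nonneg _)).2 fun x => g.norm_coe_le_norm _
    have hRn : ∀ n, ‖R n‖ ≤ ∏ γ ∈ F.erase γ₀, ‖f γ‖ := fun n =>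
      (Finset.norm_prod_le _ _).trans
        (Finset.prod_le_prod (fun _ _ => norm_nonneg _) fun γ _ => hcomp _ _ _)
    have hbound : ∀ n g, ‖Λ n g‖ ≤ (∏ γ ∈ F.erase γ₀, ‖f γ‖ + ‖c‖) * ‖g‖ := by
      intro n g
      rw [hΛ, add_mul]
      refine (norm_sub_le _ _).trans (add_le_add ?_ ?_)
      · refine (norm_haarFunctional_apply_le m _).trans ((norm_mul_le _ _).trans ?_)
        rw [mul_comm]
        gcongr
        · exact hRn n
        · exact hcomp _ _ _
      · rw [norm_mul]
        gcongr
        exact norm_haarFunctional_apply_le m g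
    -- the functions in place of `f γ₀` for which the correlations converge
    let P : Submodule ℂ C(X, ℂ) :=
      { carrier := {g | Tendsto (fun n => Λ n g) atTop (𝓝 0)}
        add_mem' := fun {a b} ha hb => by
          have := Tendsto.add ha hb
          simp only [Set.mem_ofPred_eq, map_add]
          simpa using this
        zero_mem' := by simp
        smul_mem' := fun c a ha => by
          have := Tendsto.const_mul c ha
          simp only [Set.mem_ofPred_eq, map_smul, smul_eq_mul]
          simpa using this }
    have hupd : ∀ g n, ∏ γ ∈ F, ((Function.update f γ₀ g) γ).comp (iterateMap γ n)
        = g.comp (iterateMap γ₀ n) * R n := by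
      intro g n
      rw [← Finset.mul_prod_erase F _ hmem, Function.update_self]
      congr 1
      refine Finset.prod_congr rfl fun γ hγ => ?_
      rw [Function.update_of_ne (Finset.ne_of_mem_erase hγ)]
    have hupd' : ∀ g, ∏ γ ∈ F, haarFunctional m ((Function.update f γ₀ g) γ)
        = c * haarFunctional m g := by
      intro g
      rw [← Finset.mul_prod_erase F _ hmem, Function.update_self, mul_comm]
      congr 1
      refine Finset.prod_congr rfl fun γ hγ => ?_
      rw [Function.update_of_ne (Finset.ne_of_mem_erase hγ)]
    have htop : P = ⊤ := by
      refine submodule_eq_top_of_characterMap_mem m P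
        (isClosed_setOf_tendsto_zero Λ _ hbound) fun χ => ?_
      have h1 := ih (fun γ hγ => hS (Finset.mem_insert_of_mem hγ))
        (Function.update f γ₀ (characterMap χ)) (by
          intro γ hγ hγS
          by_cases hγγ : γ = γ₀
          · subst hγγ; exact ⟨χ, by simp⟩
          · rw [Function.update_of_ne hγγ]
            exact hf γ hγ (by simp [hγγ, hγS]))
      simp only [hupd, hupd'] at h1
      have h2 := h1.sub_const (c * haarFunctional m (characterMap χ))
      rw [sub_self] at h2
      exact h2
    have hfP : f γ₀ ∈ P := by rw [htop]; trivial
    have h3 : Tendsto (fun n => Λ n (f γ₀)) atTop (𝓝 0) := hfP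
    have h4 := h3.add_const (c * haarFunctional m (f γ₀))
    rw [zero_add, ← hupd', Function.update_eq_self] at h4
    refine h4.congr fun n => ?_
    rw [hΛ, ← hupd, ← hupd', Function.update_eq_self, sub_add_cancel]

/-- Indicator functions are `L¹`-limits of continuous functions with values in `[0, 1]`. -/
theorem exists_continuous_integral_indicator_sub_le {B : Set X} (hB : NullMeasurableSet B m)
    {ε : ℝ} (hε : 0 < ε) : ∃ f : C(X, ℝ), (∀ x, ‖f x‖ ≤ 1) ∧
      ∫ x, ‖B.indicator (fun _ => (1 : ℝ)) x - f x‖ ∂m ≤ ε := by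
  have hmem : MemLp (B.indicator (fun _ => (1 : ℝ))) (ENNReal.ofReal 1) m := by
    rw [ENNReal.ofReal_one, memLp_one_iff_integrable]
    exact (integrable_const 1).indicator₀ hB
  obtain ⟨g, hg, hgm⟩ := hmem.exists_boundedContinuous_integral_rpow_sub_le one_pos hε
  simp only [Real.rpow_one] at hg
  rw [ENNReal.ofReal_one, memLp_one_iff_integrable] at hmem hgm
  refine ⟨⟨fun x => max 0 (min 1 (g x)), by fun_prop⟩, fun x => ?_, ?_⟩
  · rw [ContinuousMap.coe_mk, Real.norm_of_nonneg (le_max_left _ _)]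
    exact max_le zero_le_one (min_le_left _ _)
  · refine le_trans (integral_mono_of_nonneg (Eventually.of_forall fun x => norm_nonneg _)
      (hmem.sub hgm).norm (Eventually.of_forall fun x => ?_)) hg
    simp only [ContinuousMap.coe_mk, Pi.sub_apply, Real.norm_eq_abs]
    by_cases hx : x ∈ B
    · rw [Set.indicator_of_mem hx]
      rcases le_total (g x) 1 with h1 | h1 <;> rcases le_total 0 (g x) with h0 | h0 <;>
        simp only [min_eq_left, min_eq_right, max_eq_left, max_eq_right, h1, h0, abs_le, le_abs,
          zero_le_one] <;> grind
    · rw [Set.indicator_of_notMem hx]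
      rcases le_total (g x) 1 with h1 | h1 <;> rcases le_total 0 (g x) with h0 | h0 <;>
        simp only [min_eq_left, min_eq_right, max_eq_left, max_eq_right, h1, h0, abs_le, le_abs,
          zero_le_one] <;> grind

theorem measurePreserving_iterate_of_surjective {γ : X →ₜ* X} (hγ : Function.Surjective γ)
    (n : ℕ) : MeasurePreserving ((⇑γ)^[n]) m m :=
  ((γ.toMonoidHom).measurePreserving (μ := m) (ν := m) γ.continuous_toFun hγ rfl).iterate n

/-- A set of epimorphisms is mixing if relations between characters occur only finitely often. -/
theorem isMixingSet_of_eventually_prod_ne_one {F : Finset (X →ₜ* X)}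
    (hF : ∀ γ ∈ F, Function.Surjective γ) (hcard : 1 < F.card)
    (h : ∀ χ : (X →ₜ* X) → (X →ₜ* Circle), (∃ γ ∈ F, χ γ ≠ 1) →
      ∀ᶠ n in atTop, ∏ γ ∈ F, ((dualHom γ) ^ n) (χ γ) ≠ 1) : IsMixingSet m F := by
  classical
  refine ⟨hcard, fun B hB => ?_⟩
  rw [← ENNReal.tendsto_toReal_iff (fun n => measure_ne_top _ _)
    (ENNReal.prod_ne_top fun γ _ => measure_ne_top _ _)]
  set u : (X →ₜ* X) → X → ℝ := fun γ => (B γ).indicator (fun _ => (1 : ℝ)) with hu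
  have hu1 : ∀ γ x, ‖u γ x‖ ≤ 1 := fun γ x => by
    simp only [hu, Set.indicator_apply]; split_ifs <;> simp
  have huint : ∀ γ ∈ F, Integrable (u γ) m := fun γ hγ => (integrable_const 1).indicator₀ (hB γ hγ)
  have hpre : ∀ n, ∀ γ ∈ F, NullMeasurableSet ((⇑γ)^[n] ⁻¹' B γ) m := fun n γ hγ =>
    (hB γ hγ).preimage
      (measurePreserving_iterate_of_surjective m (hF γ hγ) n).quasiMeasurePreserving
  have hprod_ind : ∀ n x, ∏ γ ∈ F, u γ ((⇑γ)^[n] x)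
      = (⋂ γ ∈ F, (⇑γ)^[n] ⁻¹' B γ).indicator (fun _ => (1 : ℝ)) x := by
    intro n x
    by_cases hx : x ∈ ⋂ γ ∈ F, (⇑γ)^[n] ⁻¹' B γ
    · rw [Set.indicator_of_mem hx]
      rw [Set.mem_iInter₂] at hx
      exact Finset.prod_eq_one fun γ hγ =>
        Set.indicator_of_mem (s := B γ) (hx γ hγ) _
    · rw [Set.indicator_of_notMem hx]
      rw [Set.mem_iInter₂] at hx
      push Not at hx
      obtain ⟨γ, hγ, hx⟩ := hx
      exact Finset.prod_eq_zero hγ (Set.indicator_of_notMem (s := B γ) hx _)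
  have hinter : ∀ n, NullMeasurableSet (⋂ γ ∈ F, (⇑γ)^[n] ⁻¹' B γ) m := fun n =>
    NullMeasurableSet.biInter F.countable_toSet (hpre n)
  have hmeas : ∀ n, (m (⋂ γ ∈ F, (⇑γ)^[n] ⁻¹' B γ)).toReal
      = ∫ x, ∏ γ ∈ F, u γ ((⇑γ)^[n] x) ∂m := by
    intro n
    simp only [hprod_ind]
    rw [integral_indicator₀ (hinter n)]
    simp [Measure.real]
  have hmeasB : ∀ γ ∈ F, (m (B γ)).toReal = ∫ x, u γ x ∂m := by
    intro γ hγ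
    rw [hu, integral_indicator₀ (hB γ hγ)]
    simp [Measure.real]
  have hlim : (∏ γ ∈ F, m (B γ)).toReal = ∏ γ ∈ F, ∫ x, u γ x ∂m := by
    rw [ENNReal.toReal_prod]
    exact Finset.prod_congr rfl hmeasB
  rw [hlim]
  simp only [hmeas]
  rw [Metric.tendsto_atTop]
  intro ε hε
  have hcard0 : (0 : ℝ) < F.card := by exact_mod_cast (by omega : 0 < F.card)
  set η : ℝ := ε / (4 * F.card) with hη
  have hηpos : 0 < η := by positivity
  choose! f hf1 hfε using fun γ (hγ : γ ∈ F) =>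
    exists_continuous_integral_indicator_sub_le m (hB γ hγ) hηpos
  have hfint : ∀ γ, Integrable (f γ) m := fun γ =>
    (f γ).continuous.integrable_of_hasCompactSupport (HasCompactSupport.of_compactSpace _)
  -- the correlations of the approximating functions converge
  have hconv : Tendsto (fun n : ℕ => ∫ x, ∏ γ ∈ F, f γ ((⇑γ)^[n] x) ∂m) atTop
      (𝓝 (∏ γ ∈ F, ∫ x, f γ x ∂m)) := by
    have h1 := tendsto_haarFunctional_prod m F h
      (fun γ => ⟨fun x => (f γ x : ℂ), by fun_prop⟩)
    have h2 := (Complex.continuous_re.tendsto _).comp h1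
    convert h2 using 1
    · ext n
      have : (haarFunctional m (∏ γ ∈ F, (⟨fun x => (f γ x : ℂ), by fun_prop⟩ : C(X, ℂ)).comp
          (iterateMap γ n))) = ((∫ x, ∏ γ ∈ F, f γ ((⇑γ)^[n] x) ∂m : ℝ) : ℂ) := by
        rw [← integral_complex_ofReal]
        refine integral_congr_ae (Eventually.of_forall fun x => ?_)
        simp [ContinuousMap.coe_prod, iterateMap]
      rw [Function.comp_apply, this, Complex.ofReal_re]
    · congr 1
      have : ∀ γ, haarFunctional m (⟨fun x => (f γ x : ℂ), by fun_prop⟩ : C(X, ℂ))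
          = ((∫ x, f γ x ∂m : ℝ) : ℂ) := fun γ => by
        rw [← integral_complex_ofReal]; rfl
      simp only [this]
      rw [← Complex.ofReal_prod, Complex.ofReal_re]
  obtain ⟨N, hN⟩ := Metric.tendsto_atTop.1 hconv (ε / 2) (half_pos hε)
  refine ⟨N, fun n hn => ?_⟩
  have hFη : F.card * η = ε / 4 := by rw [hη]; field_simp
  have hA : |∫ x, ∏ γ ∈ F, u γ ((⇑γ)^[n] x) ∂m - ∫ x, ∏ γ ∈ F, f γ ((⇑γ)^[n] x) ∂m| ≤ ε / 4 := by
    have hi1 : Integrable (fun x => ∏ γ ∈ F, u γ ((⇑γ)^[n] x)) m := by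
      simp only [hprod_ind]
      exact (integrable_const 1).indicator₀ (hinter n)
    have hi2 : Integrable (fun x => ∏ γ ∈ F, f γ ((⇑γ)^[n] x)) m := by
      have : Continuous (fun x => ∏ γ ∈ F, f γ ((⇑γ)^[n] x)) :=
        continuous_finsetProd _ fun γ _ =>
          (f γ).continuous.comp (γ.continuous_toFun.iterate n)
      exact this.integrable_of_hasCompactSupport (HasCompactSupport.of_compactSpace _)
    rw [← integral_sub hi1 hi2, ← Real.norm_eq_abs]
    have hi3 : ∀ γ ∈ F, Integrable (fun x => ‖u γ ((⇑γ)^[n] x) - f γ ((⇑γ)^[n] x)‖) m :=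
      fun γ hγ =>
        ((measurePreserving_iterate_of_surjective m (hF γ hγ) n).integrable_comp_of_integrable
          ((huint γ hγ).sub (hfint γ)).norm)
    calc ‖∫ x, (∏ γ ∈ F, u γ ((⇑γ)^[n] x) - ∏ γ ∈ F, f γ ((⇑γ)^[n] x)) ∂m‖
        ≤ ∫ x, ∑ γ ∈ F, ‖u γ ((⇑γ)^[n] x) - f γ ((⇑γ)^[n] x)‖ ∂m :=
          norm_integral_le_of_norm_le (integrable_finsetSum _ hi3) (Eventually.of_forall fun x =>
            norm_prod_sub_prod_le_sum F _ _ (fun γ _ => hu1 _ _) (fun γ hγ => hf1 γ hγ _))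
      _ = ∑ γ ∈ F, ∫ x, ‖u γ ((⇑γ)^[n] x) - f γ ((⇑γ)^[n] x)‖ ∂m := integral_finsetSum _ hi3
      _ ≤ ∑ γ ∈ F, η := by
          refine Finset.sum_le_sum fun γ hγ => ?_
          have hp := measurePreserving_iterate_of_surjective m (hF γ hγ) n
          have hi4 : Integrable (fun x => ‖u γ x - f γ x‖) m := ((huint γ hγ).sub (hfint γ)).norm
          have h5 := integral_map (μ := m) hp.measurable.aemeasurable
            (f := fun x => ‖u γ x - f γ x‖) (by rw [hp.map_eq]; exact hi4.aestronglyMeasurable)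
          rw [hp.map_eq] at h5
          rw [← h5]
          exact hfε γ hγ
      _ = ε / 4 := by rw [Finset.sum_const, nsmul_eq_mul, hFη]
  have hC : |∏ γ ∈ F, ∫ x, u γ x ∂m - ∏ γ ∈ F, ∫ x, f γ x ∂m| ≤ ε / 4 := by
    have hb1 : ∀ γ ∈ F, ‖∫ x, u γ x ∂m‖ ≤ 1 := fun γ _ => by
      simpa using norm_integral_le_of_norm_le_const (μ := m) (Eventually.of_forall (hu1 γ))
    have hb2 : ∀ γ ∈ F, ‖∫ x, f γ x ∂m‖ ≤ 1 := fun γ hγ => by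
      simpa using norm_integral_le_of_norm_le_const (μ := m) (Eventually.of_forall (hf1 γ hγ))
    refine (norm_prod_sub_prod_le_sum F _ _ hb1 hb2).trans ?_
    calc ∑ γ ∈ F, ‖∫ x, u γ x ∂m - ∫ x, f γ x ∂m‖ ≤ ∑ γ ∈ F, η := by
          refine Finset.sum_le_sum fun γ hγ => ?_
          rw [← integral_sub (huint γ hγ) (hfint γ)]
          exact (norm_integral_le_integral_norm _).trans (hfε γ hγ)
      _ = ε / 4 := by rw [Finset.sum_const, nsmul_eq_mul, hFη]
  have hD := hN n hn
  rw [Real.dist_eq] at hD ⊢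
  rw [abs_le] at hA hC
  rw [abs_lt] at hD ⊢
  constructor <;> linarith [hA.1, hA.2, hC.1, hC.2, hD.1, hD.2]

end Mixing

/-! ### The Skolem–Mahler–Lech theorem for orbits of a linear automorphism -/

section Newton

variable {p : ℕ} [Fact p.Prime]

/-- Dividing a polynomial by `X - t`, with `t` a `p`-adic integer, shifts upper bounds for its high
coefficients by one degree. -/
theorem norm_coeff_le_of_eq_X_sub_C_mul {P Q : Polynomial ℚ_[p]} {t : ℚ_[p]} (ht : ‖t‖ ≤ 1)
    (hPQ : P = (Polynomial.X - Polynomial.C t) * Q) {k : ℕ} {c : ℝ} (hc : 0 ≤ c)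
    (hP : ∀ j, k + 1 ≤ j → ‖P.coeff j‖ ≤ c) (j : ℕ) (hj : k ≤ j) : ‖Q.coeff j‖ ≤ c := by
  suffices H : ∀ i j, k ≤ j → Q.natDegree + 1 ≤ j + i → ‖Q.coeff j‖ ≤ c from
    H (Q.natDegree + 1) j hj (by omega)
  intro i
  induction i with
  | zero =>
    intro j _ h
    rw [Polynomial.coeff_eq_zero_of_natDegree_lt (by omega), norm_zero]
    exact hc
  | succ i ih =>
    intro j hj h
    have h1 : Q.coeff j = P.coeff (j + 1) + t * Q.coeff (j + 1) := by
      rw [hPQ, sub_mul, Polynomial.coeff_sub, Polynomial.coeff_X_mul, Polynomial.coeff_C_mul]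
      ring
    rw [h1]
    refine (Padic.nonarchimedean _ _).trans (max_le (hP _ (by omega)) ?_)
    rw [norm_mul]
    exact (mul_le_of_le_one_left (norm_nonneg _) ht).trans (ih (j + 1) (by omega) (by omega))

/-- A polynomial with `k` zeros in the `p`-adic integers is bounded there by its coefficients in
degrees at least `k`. -/
theorem norm_eval_le_of_card_roots (s : Finset ℚ_[p]) (hs : ∀ t ∈ s, ‖t‖ ≤ 1) {c : ℝ} (hc : 0 ≤ c)
    (P : Polynomial ℚ_[p]) (hroot : ∀ t ∈ s, P.eval t = 0)
    (hP : ∀ j, s.card ≤ j → ‖P.coeff j‖ ≤ c) {x : ℚ_[p]} (hx : ‖x‖ ≤ 1) : ‖P.eval x‖ ≤ c := by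
  classical
  induction s using Finset.induction_on generalizing P with
  | empty =>
    rw [Polynomial.eval_eq_sum_range]
    refine IsUltrametricDist.norm_sum_le_of_forall_le_of_nonneg hc fun j _ => ?_
    rw [norm_mul, norm_pow]
    exact (mul_le_of_le_one_right (norm_nonneg _) (pow_le_one₀ (norm_nonneg _) hx)).trans
      (hP j (by simp))
  | insert t s ht ih =>
    obtain ⟨Q, hQ⟩ := Polynomial.dvd_iff_isRoot.2 (hroot t (Finset.mem_insert_self _ _))
    have ht1 := hs t (Finset.mem_insert_self _ _)
    have h1 : ‖Q.eval x‖ ≤ c := by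
      refine ih (fun r hr => hs r (Finset.mem_insert_of_mem hr)) Q (fun r hr => ?_) fun j hj => ?_
      · have h2 := hroot r (Finset.mem_insert_of_mem hr)
        rw [hQ, Polynomial.eval_mul] at h2
        refine (mul_eq_zero.1 h2).resolve_left fun h0 => ?_
        rw [Polynomial.eval_sub, Polynomial.eval_X, Polynomial.eval_C, sub_eq_zero] at h0
        exact ht (h0 ▸ hr)
      · refine norm_coeff_le_of_eq_X_sub_C_mul ht1 hQ hc (fun i hi => hP i ?_) j hj
        rwa [Finset.card_insert_of_notMem ht]
    rw [hQ, Polynomial.eval_mul, norm_mul]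
    refine (mul_le_of_le_one_left (norm_nonneg _) ?_).trans h1
    rw [Polynomial.eval_sub, Polynomial.eval_X, Polynomial.eval_C, sub_eq_add_neg]
    refine (Padic.nonarchimedean _ _).trans (max_le hx ?_)
    rwa [norm_neg]

theorem norm_sq_pow_div_factorial_le (i : ℕ) :
    ‖((p : ℚ_[p]) ^ 2) ^ i / (i.factorial : ℚ_[p])‖ ≤ ((p : ℝ)⁻¹) ^ i := by
  have hp : (1 : ℝ) ≤ p := by exact_mod_cast (Fact.out : p.Prime).one_lt.le
  have hp0 : (0 : ℝ) < p := by linarith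
  have hv : padicValNat p i.factorial ≤ i := by
    rcases Nat.eq_zero_or_pos i with rfl | h
    · simp
    · exact (padicValNat_factorial_lt_of_ne_zero p h.ne').le
  have hf : (i.factorial : ℚ_[p]) ≠ 0 := by exact_mod_cast i.factorial_ne_zero
  have h1 : ‖(i.factorial : ℚ_[p])‖ = ((p : ℝ) ^ padicValNat p i.factorial)⁻¹ := by
    rw [Padic.norm_eq_zpow_neg_valuation hf, Padic.valuation_natCast, zpow_neg, zpow_natCast]
  rw [norm_div, norm_pow, norm_pow, Padic.norm_p, h1, div_inv_eq_mul, ← pow_mul, mul_comm 2 i,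
    pow_mul, sq, mul_assoc]
  refine mul_le_of_le_one_right (by positivity) ?_
  rw [inv_pow, inv_mul_le_iff₀ (by positivity), mul_one]
  exact pow_le_pow_right₀ hp hv

/-- A Newton series `n ↦ ∑ (n choose j) p ^ (2 j) d j` with bounded coefficients which vanishes
at infinitely many natural numbers vanishes at all of them. Its partial sums are polynomials with
rapidly decreasing coefficients and with more and more zeros. -/
theorem newton_series_eq_zero_of_infinite (d : ℕ → ℚ_[p]) (hd : ∀ j, ‖d j‖ ≤ 1)
    (hinf : {n : ℕ | ∑ j ∈ Finset.range (n + 1),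
      (n.choose j : ℚ_[p]) * ((p : ℚ_[p]) ^ 2) ^ j * d j = 0}.Infinite) (n : ℕ) :
    ∑ j ∈ Finset.range (n + 1), (n.choose j : ℚ_[p]) * ((p : ℚ_[p]) ^ 2) ^ j * d j = 0 := by
  classical
  have hp1 : (1 : ℝ) < p := by exact_mod_cast (Fact.out : p.Prime).one_lt
  have hinv : (p : ℝ)⁻¹ < 1 := inv_lt_one_of_one_lt₀ hp1
  have hinv0 : 0 ≤ (p : ℝ)⁻¹ := by positivity
  have hnat : ∀ t : ℕ, ‖(t : ℚ_[p])‖ ≤ 1 := fun t => by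
    simpa using Padic.norm_int_le_one (p := p) (t : ℤ)
  have hbound : ∀ k : ℕ, ‖∑ j ∈ Finset.range (n + 1),
      (n.choose j : ℚ_[p]) * ((p : ℚ_[p]) ^ 2) ^ j * d j‖ ≤ ((p : ℝ)⁻¹) ^ k := by
    intro k
    obtain ⟨s, hs, hsk⟩ := hinf.exists_subset_card_eq k
    -- the partial sum up to `N` agrees with the series at `n` and at the zeros in `s`
    set N := max n (s.sup id) with hN
    set P : Polynomial ℚ_[p] := ∑ i ∈ Finset.range (N + 1),
      Polynomial.C (((p : ℚ_[p]) ^ 2) ^ i / (i.factorial : ℚ_[p]) * d i) *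
        (descPochhammer ℤ i).map (Int.castRingHom ℚ_[p]) with hP
    have heval : ∀ t : ℕ, t ≤ N → P.eval (t : ℚ_[p]) = ∑ j ∈ Finset.range (t + 1),
        (t.choose j : ℚ_[p]) * ((p : ℚ_[p]) ^ 2) ^ j * d j := by
      intro t ht
      rw [hP, Polynomial.eval_finsetSum]
      rw [← Finset.sum_subset (Finset.range_subset_range.2 (Nat.succ_le_succ ht))]
      · refine Finset.sum_congr rfl fun i _ => ?_
        have hf : (i.factorial : ℚ_[p]) ≠ 0 := by exact_mod_cast i.factorial_ne_zero
        rw [Polynomial.eval_mul, Polynomial.eval_C, descPochhammer_map,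
          descPochhammer_eval_eq_descFactorial, Nat.descFactorial_eq_factorial_mul_choose]
        push_cast
        field_simp
      · intro i _ hi
        rw [Finset.mem_range, not_lt] at hi
        rw [Polynomial.eval_mul, descPochhammer_map, descPochhammer_eval_eq_descFactorial,
          Nat.descFactorial_of_lt (by omega)]
        simp
    rw [← heval n (le_max_left _ _)]
    refine norm_eval_le_of_card_roots (s.image fun t : ℕ => (t : ℚ_[p])) ?_ (by positivity) P ?_ ?_
      (hnat n)
    · intro t ht
      obtain ⟨r, -, rfl⟩ := Finset.mem_image.1 ht
      exact hnat r
    · intro t ht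
      obtain ⟨r, hr, rfl⟩ := Finset.mem_image.1 ht
      rw [heval r (le_trans (Finset.le_sup (f := id) hr) (le_max_right _ _))]
      exact hs hr
    · intro j hj
      rw [Finset.card_image_of_injective _ Nat.cast_injective, hsk] at hj
      rw [hP, Polynomial.finsetSum_coeff]
      refine IsUltrametricDist.norm_sum_le_of_forall_le_of_nonneg (by positivity) fun i _ => ?_
      rw [Polynomial.coeff_C_mul, Polynomial.coeff_map]
      rcases lt_or_ge i j with hij | hij
      · rw [Polynomial.coeff_eq_zero_of_natDegree_lt (by rwa [descPochhammer_natDegree])]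
        simp
      · rw [norm_mul, norm_mul]
        have h1 := norm_sq_pow_div_factorial_le (p := p) i
        have h2 : ((p : ℝ)⁻¹) ^ i ≤ ((p : ℝ)⁻¹) ^ k :=
          pow_le_pow_of_le_one hinv0 hinv.le (hj.trans hij)
        have h3 := Padic.norm_int_le_one (p := p) ((descPochhammer ℤ i).coeff j)
        exact (mul_le_of_le_one_right (by positivity) h3).trans
          ((mul_le_of_le_one_right (norm_nonneg _) (hd i)).trans (h1.trans h2))
  rw [← norm_le_zero_iff]
  exact ge_of_tendsto' (tendsto_pow_atTop_nhds_zero_of_lt_one hinv0 hinv) hbound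

/-- If `S ≡ 1` modulo `p ^ 2`, a matrix coefficient of the powers of `S` which vanishes infinitely
often vanishes identically. -/
theorem dotProduct_pow_mulVec_eq_zero_of_infinite {n : Type*} [Fintype n] [DecidableEq n]
    (B : Matrix n n ℤ_[p]) (l w : n → ℤ_[p])
    (hinf : {k : ℕ | l ⬝ᵥ ((1 + (p : ℤ_[p]) ^ 2 • B) ^ k).mulVec w = 0}.Infinite) (k : ℕ) :
    l ⬝ᵥ ((1 + (p : ℤ_[p]) ^ 2 • B) ^ k).mulVec w = 0 := by
  have hexp : ∀ k : ℕ, ((l ⬝ᵥ ((1 + (p : ℤ_[p]) ^ 2 • B) ^ k).mulVec w : ℤ_[p]) : ℚ_[p])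
      = ∑ j ∈ Finset.range (k + 1), (k.choose j : ℚ_[p]) * ((p : ℚ_[p]) ^ 2) ^ j *
        ((l ⬝ᵥ (B ^ j).mulVec w : ℤ_[p]) : ℚ_[p]) := by
    intro k
    have h1 : (1 + (p : ℤ_[p]) ^ 2 • B) ^ k
        = ∑ j ∈ Finset.range (k + 1), ((k.choose j : ℤ_[p]) * ((p : ℤ_[p]) ^ 2) ^ j) • B ^ j := by
      rw [add_comm, (Commute.one_right ((p : ℤ_[p]) ^ 2 • B)).add_pow]
      refine Finset.sum_congr rfl fun j _ => ?_
      rw [one_pow, mul_one, smul_pow, mul_smul, Nat.cast_smul_eq_nsmul, nsmul_eq_mul,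
        Nat.cast_comm]
    have h2 : l ⬝ᵥ ((1 + (p : ℤ_[p]) ^ 2 • B) ^ k).mulVec w
        = ∑ j ∈ Finset.range (k + 1), ((k.choose j : ℤ_[p]) * ((p : ℤ_[p]) ^ 2) ^ j) *
          (l ⬝ᵥ (B ^ j).mulVec w) := by
      rw [h1, Matrix.sum_mulVec, dotProduct_sum]
      refine Finset.sum_congr rfl fun j _ => ?_
      rw [Matrix.smul_mulVec, dotProduct_smul, smul_eq_mul]
    rw [h2, PadicInt.coe_sum]
    refine Finset.sum_congr rfl fun j _ => ?_
    push_cast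
    rfl
  have hz : ∀ k, l ⬝ᵥ ((1 + (p : ℤ_[p]) ^ 2 • B) ^ k).mulVec w = 0 ↔
      ∑ j ∈ Finset.range (k + 1), (k.choose j : ℚ_[p]) * ((p : ℚ_[p]) ^ 2) ^ j *
        ((l ⬝ᵥ (B ^ j).mulVec w : ℤ_[p]) : ℚ_[p]) = 0 := fun k => by
    rw [← hexp, PadicInt.coe_eq_zero]
  simp only [hz] at hinf ⊢
  exact newton_series_eq_zero_of_infinite _ (fun j => PadicInt.norm_le_one _) hinf k

/-- Some positive power of an invertible `p`-adic integer matrix is congruent to `1` modulo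
`p ^ 2`. -/
theorem exists_pow_eq_one_add_sq_smul {n : Type*} [Fintype n] [DecidableEq n]
    (u : (Matrix n n ℤ_[p])ˣ) : ∃ q, 0 < q ∧ ∃ B : Matrix n n ℤ_[p],
      (u : Matrix n n ℤ_[p]) ^ q = 1 + (p : ℤ_[p]) ^ 2 • B := by
  have : NeZero (p ^ 2) := ⟨pow_ne_zero 2 (Fact.out : p.Prime).ne_zero⟩
  let φ : Matrix n n ℤ_[p] →+* Matrix n n (ZMod (p ^ 2)) := (PadicInt.toZModPow 2).mapMatrix
  obtain ⟨q, hq, hq1⟩ := (isOfFinOrder_of_finite (Units.map φ.toMonoidHom u)).exists_pow_eq_one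
  have h1 : φ ((u : Matrix n n ℤ_[p]) ^ q) = 1 := by
    rw [map_pow]
    exact congrArg Units.val hq1
  have h2 : ∀ i j, ∃ b : ℤ_[p], ((u : Matrix n n ℤ_[p]) ^ q - 1) i j = (p : ℤ_[p]) ^ 2 * b := by
    intro i j
    have h3 : ((u : Matrix n n ℤ_[p]) ^ q - 1) i j ∈ Ideal.span {(p : ℤ_[p]) ^ 2} := by
      rw [← PadicInt.ker_toZModPow, RingHom.mem_ker]
      have h4 : φ ((u : Matrix n n ℤ_[p]) ^ q - 1) = 0 := by rw [map_sub, h1, map_one, sub_self]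
      exact congrFun (congrFun h4 i) j
    exact Ideal.mem_span_singleton'.1 h3 |>.imp fun b hb => by rw [← hb, mul_comm]
  choose B hB using h2
  refine ⟨q, hq, Matrix.of B, ?_⟩
  rw [← sub_eq_iff_eq_add']
  ext i j
  rw [hB]
  rfl

end Newton

theorem exists_infinite_setOf_add_mul_mem {s : Set ℕ} (hs : s.Infinite) {q : ℕ} (hq : 0 < q) :
    ∃ r, {k | r + q * k ∈ s}.Infinite := by
  by_contra! h
  refine hs (((Set.finite_lt_nat q).biUnion fun r _ => (h r).image fun k => r + q * k).subset ?_)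
  intro n hn
  rw [Set.mem_iUnion₂]
  refine ⟨n % q, Nat.mod_lt n hq, n / q, ?_, Nat.mod_add_div n q⟩
  rw [Set.mem_ofPred_eq, Nat.mod_add_div]
  exact hn

theorem exists_prime_forall_norm_le_one (s : Finset ℚ) :
    ∃ (p : ℕ) (_ : Fact p.Prime), ∀ x ∈ s, ‖(x : ℚ_[p])‖ ≤ 1 := by
  obtain ⟨p, hp, hpp⟩ := Nat.exists_infinite_primes (∏ x ∈ s, x.den + 1)
  have : Fact p.Prime := ⟨hpp⟩
  refine ⟨p, this, fun x hx => Padic.norm_rat_le_one fun hdvd => ?_⟩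
  have h1 : p ∣ ∏ x ∈ s, x.den := hdvd.trans (Finset.dvd_prod_of_mem _ hx)
  have h2 : 0 < ∏ x ∈ s, x.den := Finset.prod_pos fun x _ => x.pos
  have := Nat.le_of_dvd h2 h1
  omega

/-- The matrix form of the Skolem–Mahler–Lech theorem: at a prime for which all the data are
integral, some power of `M` is congruent to `1`. -/
theorem exists_forall_mulVec_pow_eq_zero {n k : Type*} [Fintype n] [DecidableEq n] [Fintype k]
    (M N : Matrix n n ℚ) (hMN : M * N = 1) (L : Matrix k n ℚ) (w : n → ℚ)
    (hinf : {i : ℕ | L.mulVec ((M ^ i).mulVec w) = 0}.Infinite) :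
    ∃ q r, 0 < q ∧ ∀ i, L.mulVec ((M ^ (r + q * i)).mulVec w) = 0 := by
  classical
  obtain ⟨p, hp, hint⟩ := exists_prime_forall_norm_le_one
    (((Finset.univ.image fun ij : n × n => M ij.1 ij.2) ∪
      (Finset.univ.image fun ij : n × n => N ij.1 ij.2)) ∪
      ((Finset.univ.image fun ij : k × n => L ij.1 ij.2) ∪ (Finset.univ.image w)))
  have hM : ∀ i j, ‖(M i j : ℚ_[p])‖ ≤ 1 := fun i j => hint _ (by
    simp only [Finset.mem_union, Finset.mem_image]; exact .inl (.inl ⟨(i, j), by simp⟩))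
  have hN : ∀ i j, ‖(N i j : ℚ_[p])‖ ≤ 1 := fun i j => hint _ (by
    simp only [Finset.mem_union, Finset.mem_image]; exact .inl (.inr ⟨(i, j), by simp⟩))
  have hL : ∀ i j, ‖(L i j : ℚ_[p])‖ ≤ 1 := fun i j => hint _ (by
    simp only [Finset.mem_union, Finset.mem_image]; exact .inr (.inl ⟨(i, j), by simp⟩))
  have hw : ∀ i, ‖(w i : ℚ_[p])‖ ≤ 1 := fun i => hint _ (by
    simp only [Finset.mem_union, Finset.mem_image]; exact .inr (.inr ⟨i, by simp⟩))
  let M' : Matrix n n ℤ_[p] := Matrix.of fun i j => ⟨M i j, hM i j⟩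
  let N' : Matrix n n ℤ_[p] := Matrix.of fun i j => ⟨N i j, hN i j⟩
  let L' : Matrix k n ℤ_[p] := Matrix.of fun i j => ⟨L i j, hL i j⟩
  let w' : n → ℤ_[p] := fun i => ⟨w i, hw i⟩
  let φ : ℤ_[p] →+* ℚ_[p] := PadicInt.Coe.ringHom
  let ψ : ℚ →+* ℚ_[p] := algebraMap ℚ ℚ_[p]
  have hφ : Function.Injective φ := Subtype.val_injective
  have hψ : Function.Injective ψ := ψ.injective
  have hψa : ∀ x : ℚ, ψ x = (x : ℚ_[p]) := fun x => by simp [ψ]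
  have hMφ : M'.map φ = M.map ψ := by
    ext i j; rw [Matrix.map_apply, Matrix.map_apply, hψa]; rfl
  have hNφ : N'.map φ = N.map ψ := by
    ext i j; rw [Matrix.map_apply, Matrix.map_apply, hψa]; rfl
  have hLφ : L'.map φ = L.map ψ := by
    ext i j; rw [Matrix.map_apply, Matrix.map_apply, hψa]; rfl
  have hwφ : φ ∘ w' = ψ ∘ w := by
    ext i; rw [Function.comp_apply, Function.comp_apply, hψa]; rfl
  have hMN' : M' * N' = 1 := by
    apply Matrix.map_injective hφ
    change φ.mapMatrix (M' * N') = φ.mapMatrix 1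
    rw [map_mul, map_one]
    change M'.map φ * N'.map φ = 1
    rw [hMφ, hNφ]
    change ψ.mapMatrix M * ψ.mapMatrix N = 1
    rw [← map_mul, hMN, map_one]
  let u : (Matrix n n ℤ_[p])ˣ := ⟨M', N', hMN', mul_eq_one_comm.1 hMN'⟩
  -- vanishing may be tested over the `p`-adic integers
  have hiff : ∀ i, L.mulVec ((M ^ i).mulVec w) = 0 ↔
      ∀ a, (L' a) ⬝ᵥ (M' ^ i).mulVec w' = 0 := by
    intro i
    rw [funext_iff]
    refine forall_congr' fun a => ?_
    have h1 : φ ((L' a) ⬝ᵥ (M' ^ i).mulVec w') = ψ ((L.mulVec ((M ^ i).mulVec w)) a) := by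
      have h2 : (M' ^ i).map φ = (M ^ i).map ψ := by
        change φ.mapMatrix (M' ^ i) = ψ.mapMatrix (M ^ i)
        rw [map_pow, map_pow]
        change (M'.map φ) ^ i = (M.map ψ) ^ i
        rw [hMφ]
      change φ ((L'.mulVec ((M' ^ i).mulVec w')) a) = _
      rw [RingHom.map_mulVec, RingHom.map_mulVec, hLφ]
      refine congrArg (fun v => (L.map ψ).mulVec v a) (funext fun b => ?_)
      rw [Function.comp_apply, Function.comp_apply, RingHom.map_mulVec, RingHom.map_mulVec, h2, hwφ]
    rw [Pi.zero_apply, ← map_eq_zero_iff ψ hψ, ← h1, map_eq_zero_iff φ hφ]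
  obtain ⟨q, hq, B, hB⟩ := exists_pow_eq_one_add_sq_smul u
  have hB' : M' ^ q = 1 + (p : ℤ_[p]) ^ 2 • B := hB
  obtain ⟨r, hr⟩ := exists_infinite_setOf_add_mul_mem hinf hq
  refine ⟨q, r, hq, fun i => (hiff _).2 fun a => ?_⟩
  have hsplit : ∀ i, (L' a) ⬝ᵥ (M' ^ (r + q * i)).mulVec w'
      = (L' a) ⬝ᵥ ((1 + (p : ℤ_[p]) ^ 2 • B) ^ i).mulVec ((M' ^ r).mulVec w') := by
    intro i
    rw [add_comm r, pow_add, pow_mul, hB', Matrix.mulVec_mulVec]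
  rw [hsplit]
  refine dotProduct_pow_mulVec_eq_zero_of_infinite B (L' a) _ (hr.mono fun i hi => ?_) i
  rw [Set.mem_ofPred_eq, ← hsplit]
  exact (hiff _).1 hi a

/-- The Skolem–Mahler–Lech theorem for the visits of an orbit of an automorphism to the kernel
of a linear map: if there are infinitely many, they include an arithmetic progression. -/
theorem exists_forall_linearMap_pow_eq_zero {W V : Type*} [AddCommGroup W] [Module ℚ W]
    [FiniteDimensional ℚ W] [AddCommGroup V] [Module ℚ V] [FiniteDimensional ℚ V]
    (T : Module.End ℚ W) (hT : Function.Injective T) (L : W →ₗ[ℚ] V) (w : W)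
    (hinf : {i : ℕ | L ((T ^ i) w) = 0}.Infinite) :
    ∃ q r, 0 < q ∧ ∀ i, L ((T ^ (r + q * i)) w) = 0 := by
  classical
  let b := Module.finBasis ℚ W
  let c := Module.finBasis ℚ V
  let e := LinearEquiv.ofInjectiveEndo T hT
  have hTe : T ∘ₗ e.symm.toLinearMap = LinearMap.id := by
    ext v
    exact e.apply_symm_apply v
  have hiff : ∀ i, L ((T ^ i) w) = 0 ↔
      (LinearMap.toMatrix b c L).mulVec
        (((LinearMap.toMatrix b b T) ^ i).mulVec (b.repr w)) = 0 := by
    intro i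
    rw [LinearMap.toMatrix_pow, LinearMap.toMatrix_mulVec_repr, LinearMap.toMatrix_mulVec_repr]
    rw [← Finsupp.coe_zero, DFunLike.coe_fn_eq, map_eq_zero_iff _ c.repr.injective]
  simp only [hiff] at hinf ⊢
  refine exists_forall_mulVec_pow_eq_zero _ (LinearMap.toMatrix b b e.symm.toLinearMap) ?_ _ _ hinf
  rw [← LinearMap.toMatrix_comp, hTe, LinearMap.toMatrix_id]

/-! ### Shortening a relation between powers of operators -/

section Shorten

theorem apply_aeval_of_intertwining {V W : Type*} [AddCommGroup V] [Module ℚ V] [AddCommGroup W]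
    [Module ℚ W] (S : Module.End ℚ V) (T : Module.End ℚ W) (f : V →ₗ[ℚ] W)
    (hf : ∀ v, f (S v) = T (f v)) (P : Polynomial ℚ) (v : V) :
    f (Polynomial.aeval S P v) = Polynomial.aeval T P (f v) := by
  induction P using Polynomial.induction_on generalizing v with
  | C a => simp [Module.algebraMap_end_apply]
  | add p q hp hq => simp [hp, hq]
  | monomial n a ih =>
    rw [pow_succ, ← mul_assoc, map_mul _ _ Polynomial.X, map_mul _ _ Polynomial.X,
      Module.End.mul_apply, Module.End.mul_apply, Polynomial.aeval_X, Polynomial.aeval_X, ih, hf]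

variable {ι V : Type*} [AddCommGroup V] [Module ℚ V]

/-- The operator acting on the `i`-th coordinate of a family of vectors by `δ i`. -/
def diagonalEnd (δ : ι → Module.End ℚ V) : Module.End ℚ (ι → V) :=
  LinearMap.pi fun i => δ i ∘ₗ LinearMap.proj i

theorem diagonalEnd_aeval_apply (δ : ι → Module.End ℚ V) (P : Polynomial ℚ) (w : ι → V) (i : ι) :
    (Polynomial.aeval (diagonalEnd δ) P w) i = Polynomial.aeval (δ i) P (w i) := by
  exact apply_aeval_of_intertwining (diagonalEnd δ) (δ i) (LinearMap.proj i) (fun _ => rfl) P w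

theorem diagonalEnd_pow_apply (δ : ι → Module.End ℚ V) (n : ℕ) (w : ι → V) (i : ι) :
    ((diagonalEnd δ ^ n) w) i = (δ i ^ n) (w i) := by
  have := diagonalEnd_aeval_apply δ (Polynomial.X ^ n) w i
  simpa using this

variable [FiniteDimensional ℚ V] [Fintype ι]

/-- An invariant nonzero subspace contains a nonzero vector killed by an irreducible polynomial. -/
theorem exists_irreducible_aeval_eq_zero {W : Type*} [AddCommGroup W] [Module ℚ W]
    [FiniteDimensional ℚ W] (T : Module.End ℚ W) (N : Submodule ℚ W) (hN : N ≠ ⊥)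
    (hT : ∀ v ∈ N, T v ∈ N) :
    ∃ π : Polynomial ℚ, Irreducible π ∧ ∃ w ∈ N, w ≠ 0 ∧ Polynomial.aeval T π w = 0 := by
  have : Nontrivial N := Submodule.nontrivial_iff_ne_bot.2 hN
  let S : Module.End ℚ N := T.restrict hT
  have hint : IsIntegral ℚ S := Algebra.IsIntegral.isIntegral S
  have hne0 : minpoly ℚ S ≠ 0 := minpoly.ne_zero hint
  -- the cofactor `s` of an irreducible factor `π` of the minimal polynomial does not kill `N`
  obtain ⟨π, hπ, s, hs⟩ := WfDvdMonoid.exists_irreducible_factor (minpoly.not_isUnit ℚ S) hne0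
  have hs0 : s ≠ 0 := by rintro rfl; rw [mul_zero] at hs; exact hne0 hs
  have hsS : Polynomial.aeval S s ≠ 0 := by
    intro h
    have h1 := minpoly.dvd ℚ S h
    have h2 := Polynomial.natDegree_le_of_dvd h1 hs0
    rw [hs, Polynomial.natDegree_mul hπ.ne_zero hs0] at h2
    have := hπ.natDegree_pos
    omega
  obtain ⟨v, hv⟩ : ∃ v, Polynomial.aeval S s v ≠ 0 := by
    by_contra! h
    exact hsS (LinearMap.ext h)
  have hcoe : ∀ (P : Polynomial ℚ) (x : N),
      ((Polynomial.aeval S P x : N) : W) = Polynomial.aeval T P (x : W) := by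
    exact fun P x => apply_aeval_of_intertwining S T N.subtype (fun _ => rfl) P x
  refine ⟨π, hπ, _, (Polynomial.aeval S s v).2, by simpa using hv, ?_⟩
  rw [← hcoe, ← Module.End.mul_apply, ← map_mul, ← hs, minpoly.aeval]
  rfl

/-- A relation `∑ i, δ i ^ k (b i) = 0`, valid for all `k`, can be replaced by a nonzero one with at
most `dim V + 1` nonzero terms. Choose one which is killed by an irreducible polynomial `π`, of
degree `e` say. The vectors `x i (δ i) (w i)`, with `x i` a polynomial of degree less than `e`
and `i` in a set of `dim V + 1` indices with `w i ≠ 0`, form a space of dimension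
`e * (dim V + 1)`, on which the relations for `k < e` impose `e * dim V` conditions and imply all
the others. -/
theorem exists_shorter_relation (δ : ι → Module.End ℚ V) {d : ℕ} (hd : Module.finrank ℚ V ≤ d)
    (hι : d < Fintype.card ι) (b : ι → V) (hb : b ≠ 0) (h : ∀ k : ℕ, ∑ i, (δ i ^ k) (b i) = 0) :
    ∃ E : Finset ι, E.card = d + 1 ∧ ∃ c : ι → V, (∃ i ∈ E, c i ≠ 0) ∧
      ∀ k : ℕ, ∑ i ∈ E, (δ i ^ k) (c i) = 0 := by
  classical
  -- the families which satisfy all the relations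
  let N : Submodule ℚ (ι → V) :=
    { carrier := {w | ∀ k : ℕ, ∑ i, (δ i ^ k) (w i) = 0}
      add_mem' := fun {x y} hx hy k => by
        simp only [Pi.add_apply, map_add, Finset.sum_add_distrib, hx k, hy k, add_zero]
      zero_mem' := fun k => by simp
      smul_mem' := fun a x hx k => by
        simp only [Pi.smul_apply, map_smul, ← Finset.smul_sum, hx k, smul_zero] }
  have hN : N ≠ ⊥ := fun h0 => hb ((Submodule.eq_bot_iff N).1 h0 b h)
  have hNT : ∀ v ∈ N, diagonalEnd δ v ∈ N := by
    intro v hv k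
    rw [← hv (k + 1)]
    refine Finset.sum_congr rfl fun i _ => ?_
    rw [pow_succ, Module.End.mul_apply]
    rfl
  obtain ⟨π, hπ, w, hwN, hw0, hπw⟩ := exists_irreducible_aeval_eq_zero (diagonalEnd δ) N hN hNT
  have hπi : ∀ i, Polynomial.aeval (δ i) π (w i) = 0 := fun i => by
    rw [← diagonalEnd_aeval_apply, hπw]; rfl
  set S : Finset ι := Finset.univ.filter fun i => w i ≠ 0 with hS
  rcases le_or_gt S.card (d + 1) with hcard | hcard
  · obtain ⟨E, hSE, -, hE⟩ := Finset.exists_subsuperset_card_eq (Finset.subset_univ S) hcard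
      (by rw [Finset.card_univ]; omega)
    obtain ⟨i, hi⟩ := Function.ne_iff.1 hw0
    refine ⟨E, hE, w, ⟨i, hSE (by simpa [hS] using hi), hi⟩, fun k => ?_⟩
    rw [← hwN k]
    refine Finset.sum_subset (Finset.subset_univ E) fun j _ hj => ?_
    have : w j = 0 := by
      by_contra hne
      exact hj (hSE (by simpa [hS] using hne))
    rw [this, map_zero]
  · obtain ⟨E, hES, hE⟩ := Finset.exists_subset_card_eq hcard.le
    set e := π.natDegree with he
    have hepos : 0 < e := hπ.natDegree_pos
    let Φ : (E → Polynomial.degreeLT ℚ e) →ₗ[ℚ] (Fin e → V) :=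
      LinearMap.pi fun k => ∑ i : E, ((δ i ^ (k : ℕ)) ∘ₗ LinearMap.applyₗ (w i) ∘ₗ
        (Polynomial.aeval (δ i)).toLinearMap ∘ₗ (Polynomial.degreeLT ℚ e).subtype) ∘ₗ
          LinearMap.proj i
    have hΦ : ∀ x k, Φ x k = ∑ i : E, (δ i ^ (k : ℕ))
        (Polynomial.aeval (δ i) (x i : Polynomial ℚ) (w i)) := by
      intro x k
      simp [Φ]
    have hdim : Module.finrank ℚ (Fin e → V) <
        Module.finrank ℚ (E → Polynomial.degreeLT ℚ e) := by
      rw [Module.finrank_pi_fintype, Module.finrank_pi_fintype]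
      have h1 : Module.finrank ℚ (Polynomial.degreeLT ℚ e) = e := by
        rw [(Polynomial.degreeLTEquiv ℚ e).finrank_eq, Module.finrank_fin_fun]
      simp only [h1, Finset.sum_const, Finset.card_univ, Fintype.card_fin, Fintype.card_coe, hE,
        smul_eq_mul]
      nlinarith
    have : Module.Finite ℚ (Polynomial.degreeLT ℚ e) :=
      Module.Finite.equiv (Polynomial.degreeLTEquiv ℚ e).symm
    obtain ⟨x, hxker, hx0⟩ := (Submodule.ne_bot_iff _).1
      (LinearMap.ker_ne_bot_of_finrank_lt (f := Φ) hdim)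
    obtain ⟨i₀, hi₀⟩ := Function.ne_iff.1 hx0
    let c : ι → V := fun i =>
      if hi : i ∈ E then Polynomial.aeval (δ i) (x ⟨i, hi⟩ : Polynomial ℚ) (w i) else 0
    have hc : ∀ i : E, c i = Polynomial.aeval (δ i) (x i : Polynomial ℚ) (w i) := fun i => by
      simp [c]
    have hπc : ∀ i : E, Polynomial.aeval (δ i) π (c i) = 0 := by
      intro i
      rw [hc, ← Module.End.mul_apply, ← map_mul, mul_comm, map_mul, Module.End.mul_apply, hπi,
        map_zero]
    have hlow : ∀ k < e, ∑ i : E, (δ i ^ k) (c i) = 0 := by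
      intro k hk
      have := congrFun (LinearMap.mem_ker.1 hxker) ⟨k, hk⟩
      rw [hΦ] at this
      simp only [hc]
      exact this
    refine ⟨E, hE, c, ⟨i₀, i₀.2, fun h0 => ?_⟩, fun k => ?_⟩
    · -- `x i₀` is coprime to `π`, so cannot kill `w i₀`
      have hdeg := Polynomial.mem_degreeLT.1 (x i₀).2
      have hxne : (x i₀ : Polynomial ℚ) ≠ 0 := fun h => hi₀ (Subtype.ext h)
      have hcop : IsCoprime π (x i₀ : Polynomial ℚ) := by
        refine (Irreducible.coprime_iff_not_dvd hπ).2 fun hdvd => ?_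
        have h1 := Polynomial.natDegree_le_of_dvd hdvd hxne
        rw [Polynomial.degree_eq_natDegree hxne] at hdeg
        have h2 : (x i₀ : Polynomial ℚ).natDegree < e := by exact_mod_cast hdeg
        omega
      obtain ⟨u, v, huv⟩ := hcop
      have hwi : w i₀ ≠ 0 := by simpa [hS] using hES i₀.2
      apply hwi
      have h1 := congrArg (fun P => Polynomial.aeval (δ i₀) P (w i₀)) huv
      simp only [map_add, map_mul, LinearMap.add_apply, Module.End.mul_apply, hπi, map_zero,
        zero_add, map_one, Module.End.one_apply] at h1
      rw [← hc, h0, map_zero] at h1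
      exact h1.symm
    · -- reduce `X ^ k` modulo `π`
      rw [← Finset.sum_coe_sort]
      have hmod : ∀ i : E, (δ i ^ k) (c i)
          = Polynomial.aeval (δ i) ((Polynomial.X ^ k : Polynomial ℚ) % π) (c i) := by
        intro i
        have h1 := congrArg (fun P => Polynomial.aeval (δ i) P (c i))
          (EuclideanDomain.mod_add_div (Polynomial.X ^ k : Polynomial ℚ) π)
        simp only [map_add, LinearMap.add_apply] at h1
        rw [mul_comm, map_mul, Module.End.mul_apply, hπc, map_zero, add_zero] at h1
        rw [h1]
        simp
      simp only [hmod]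
      have hdeg : ((Polynomial.X ^ k : Polynomial ℚ) % π).natDegree < e :=
        Polynomial.natDegree_mod_lt _ hepos.ne'
      simp only [Polynomial.aeval_eq_sum_range' hdeg, LinearMap.sum_apply, LinearMap.smul_apply]
      rw [Finset.sum_comm]
      refine Finset.sum_eq_zero fun j hj => ?_
      rw [← Finset.smul_sum, hlow j (Finset.mem_range.1 hj), smul_zero]

end Shorten

/-! ### Invariance of the integral of the Jacobian -/

/-- The determinant of `1 + A` is a fixed linear combination of the determinants of `1 + t A`, for
finitely many arbitrarily small `t > 0`, by Lagrange interpolation. -/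
theorem exists_det_one_add_eq_sum {r : ℕ} {t₀ : ℝ} (ht₀ : 0 < t₀) :
    ∃ (s : Finset ℝ) (c : ℝ → ℝ), (∀ t ∈ s, 0 < t ∧ t < t₀) ∧
      ∀ A : (Fin r → ℝ) →L[ℝ] (Fin r → ℝ),
        (1 + A).det = ∑ t ∈ s, c t * (1 + t • A).det := by
  classical
  obtain ⟨s, hs, hcard⟩ := (Set.Ioo_infinite ht₀).exists_subset_card_eq (r + 1)
  refine ⟨s, fun t => (Lagrange.basis s id t).eval 1, fun t ht => hs ht, fun A => ?_⟩
  let M : Matrix (Fin r) (Fin r) ℝ := LinearMap.toMatrix' (A : (Fin r → ℝ) →ₗ[ℝ] (Fin r → ℝ))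
  let P : Polynomial ℝ := Matrix.det ((Polynomial.X : Polynomial ℝ) • M.map Polynomial.C +
    (1 : Matrix (Fin r) (Fin r) ℝ).map Polynomial.C)
  have hP : ∀ t : ℝ, P.eval t = (1 + t • A).det := by
    intro t
    have h1 : (1 + t • A).det = Matrix.det (1 + t • M) := by
      rw [ContinuousLinearMap.det, ← LinearMap.det_toMatrix']
      congr 1
      simp [M, LinearMap.toMatrix'_one]
    rw [h1]
    change Polynomial.evalRingHom t (Matrix.det _) = _
    rw [RingHom.map_det]
    congr 1
    ext i j
    simp [Matrix.one_apply, apply_ite, add_comm, mul_comm t]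
  have hdeg : P.degree < s.card := by
    refine lt_of_le_of_lt Polynomial.degree_le_natDegree ?_
    have := Polynomial.natDegree_det_X_add_C_le M 1
    rw [Fintype.card_fin] at this
    rw [hcard]
    exact_mod_cast Nat.lt_succ_of_le this
  have h := Lagrange.eq_interpolate (s := s) (v := id) (f := P) Function.injective_id.injOn hdeg
  have h2 := congrArg (Polynomial.eval 1) h
  rw [Lagrange.interpolate_apply, Polynomial.eval_finsetSum, hP, one_smul] at h2
  rw [h2]
  refine Finset.sum_congr rfl fun t _ => ?_
  rw [Polynomial.eval_mul, Polynomial.eval_C, id, hP, mul_comm]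

theorem bijective_id_add_smul_of_lipschitz {E : Type*} [NormedAddCommGroup E] [NormedSpace ℝ E]
    [CompleteSpace E] {k : E → E} {C : NNReal} (hk : LipschitzWith C k) {t : ℝ} (ht : 0 ≤ t)
    (htC : t * C < 1) : Function.Bijective fun x => x + t • k x := by
  have hlip : ApproximatesLinearOn (fun x => x + t • k x)
      ((ContinuousLinearEquiv.refl ℝ E : E ≃L[ℝ] E) : E →L[ℝ] E) Set.univ (⟨t, ht⟩ * C) := by
    intro x _ y _
    have h1 : x + t • k x - (y + t • k y) - (ContinuousLinearEquiv.refl ℝ E : E →L[ℝ] E) (x - y)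
        = t • (k x - k y) := by
      simp [smul_sub]
      abel
    rw [h1, norm_smul, Real.norm_of_nonneg ht]
    have := hk.dist_le_mul x y
    rw [dist_eq_norm, dist_eq_norm] at this
    calc t * ‖k x - k y‖ ≤ t * (C * ‖x - y‖) := by gcongr
      _ = _ := by rw [← mul_assoc]; rfl
  have hc : Subsingleton E ∨ (⟨t, ht⟩ * C : NNReal) <
      ‖((ContinuousLinearEquiv.refl ℝ E).symm : E →L[ℝ] E)‖₊⁻¹ := by
    rcases subsingleton_or_nontrivial E with h | h
    · exact Or.inl h
    · right
      have : ‖((ContinuousLinearEquiv.refl ℝ E).symm : E →L[ℝ] E)‖₊ = 1 := by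
        ext
        exact ContinuousLinearMap.norm_id
      rw [this, inv_one]
      exact htC
  exact ⟨Set.injOn_univ.1 (hlip.injOn hc), hlip.surjective hc⟩

/-- The integral of the Jacobian of `id + k` over a bounded set does not change when `k` is modified
inside this set. For small `t` the maps `id + t k` are bijections, with the same image of the
set, and the Jacobians are polynomials in `t`. -/
theorem setIntegral_det_one_add_fderiv_congr {r : ℕ} {k k' : (Fin r → ℝ) → (Fin r → ℝ)}
    (hk : ContDiff ℝ 1 k) (hk' : ContDiff ℝ 1 k') (hkc : HasCompactSupport k)
    (hkc' : HasCompactSupport k') {B : Set (Fin r → ℝ)} (hB : IsCompact B)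
    (hkk' : ∀ x ∉ B, k x = k' x) :
    ∫ x in B, (1 + fderiv ℝ k x).det = ∫ x in B, (1 + fderiv ℝ k' x).det := by
  obtain ⟨C₁, hC₁⟩ := hk.lipschitzWith_of_hasCompactSupport hkc one_ne_zero
  obtain ⟨C₂, hC₂⟩ := hk'.lipschitzWith_of_hasCompactSupport hkc' one_ne_zero
  set C := max C₁ C₂ with hC
  have hL₁ : LipschitzWith C k := hC₁.weaken (le_max_left _ _)
  have hL₂ : LipschitzWith C k' := hC₂.weaken (le_max_right _ _)
  obtain ⟨δ, hδ, hdet⟩ : ∃ δ > 0, ∀ A : (Fin r → ℝ) →L[ℝ] (Fin r → ℝ), ‖A‖ < δ →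
      0 < (1 + A).det := by
    have h1 : ∀ᶠ A : (Fin r → ℝ) →L[ℝ] (Fin r → ℝ) in 𝓝 1, 0 < A.det := by
      refine ContinuousLinearMap.continuous_det.continuousAt.eventually (lt_mem_nhds ?_)
      simp [ContinuousLinearMap.det]
    obtain ⟨δ, hδ, h⟩ := Metric.eventually_nhds_iff.1 h1
    exact ⟨δ, hδ, fun A hA => h (by rwa [dist_eq_norm, add_sub_cancel_left])⟩
  -- below `t₀` the maps `id + t k` are bijective, with positive Jacobian
  set t₀ : ℝ := min (1 / (C + 1)) (δ / (C + 1)) with ht₀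
  have hC0 : (0 : ℝ) ≤ C := C.coe_nonneg
  have ht₀pos : 0 < t₀ := lt_min (by positivity) (by positivity)
  obtain ⟨s, c, hs, hsum⟩ := exists_det_one_add_eq_sum (r := r) ht₀pos
  have hpos : ∀ k : (Fin r → ℝ) → (Fin r → ℝ), LipschitzWith C k → ∀ t ∈ s, ∀ x,
      0 < (1 + t • fderiv ℝ k x).det := by
    intro k hL t ht x
    obtain ⟨ht1, ht2⟩ := hs t ht
    apply hdet
    rw [norm_smul, Real.norm_of_nonneg ht1.le]
    have h1 : ‖fderiv ℝ k x‖ ≤ C := norm_fderiv_le_of_lipschitz ℝ hL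
    calc t * ‖fderiv ℝ k x‖ ≤ t * C := by gcongr
      _ ≤ t * (C + 1) := by gcongr; linarith
      _ < δ / (C + 1) * (C + 1) := by
          have : t < δ / (C + 1) := ht2.trans_le (min_le_right _ _)
          gcongr
      _ = δ := by field_simp
  have hbij : ∀ k : (Fin r → ℝ) → (Fin r → ℝ), LipschitzWith C k → ∀ t ∈ s,
      Function.Bijective fun x => x + t • k x := by
    intro k hL t ht
    obtain ⟨ht1, ht2⟩ := hs t ht
    refine bijective_id_add_smul_of_lipschitz hL ht1.le ?_
    calc t * C ≤ t * (C + 1) := by gcongr; linarith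
      _ < 1 / (C + 1) * (C + 1) := by
          have : t < 1 / (C + 1) := ht2.trans_le (min_le_left _ _)
          gcongr
      _ = 1 := by field_simp
  have hvol : ∀ k : (Fin r → ℝ) → (Fin r → ℝ), ContDiff ℝ 1 k → LipschitzWith C k → ∀ t ∈ s,
      ∫ x in B, (1 + t • fderiv ℝ k x).det = ∫ _ in (fun x => x + t • k x) '' B, (1 : ℝ) := by
    intro k hk hL t ht
    rw [integral_image_eq_integral_abs_det_fderiv_smul volume hB.measurableSet
      (f' := fun x => (1 + t • fderiv ℝ k x : (Fin r → ℝ) →L[ℝ] (Fin r → ℝ))) (fun x _ => ?_)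
      (hbij k hL t ht).1.injOn]
    · refine integral_congr_ae (Eventually.of_forall fun x => ?_)
      simp only [smul_eq_mul, mul_one]
      rw [abs_of_pos (hpos k hL t ht x)]
    · have h1 : HasFDerivAt k (fderiv ℝ k x) x := (hk.differentiable one_ne_zero x).hasFDerivAt
      exact ((hasFDerivAt_id x).add (h1.const_smul t)).hasFDerivWithinAt
  have himage : ∀ t ∈ s, (fun x => x + t • k x) '' B = (fun x => x + t • k' x) '' B := by
    intro t ht
    rw [← compl_inj_iff, ← Set.image_compl_eq (hbij k hL₁ t ht),
      ← Set.image_compl_eq (hbij k' hL₂ t ht)]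
    exact Set.image_congr fun x hx => by rw [hkk' x hx]
  have hint : ∀ k : (Fin r → ℝ) → (Fin r → ℝ), ContDiff ℝ 1 k → ∀ t : ℝ,
      IntegrableOn (fun x => (1 + t • fderiv ℝ k x).det) B := by
    intro k hk t
    have h1 : Continuous fun x => fderiv ℝ k x := hk.continuous_fderiv one_ne_zero
    have h2 : Continuous fun x => (1 + t • fderiv ℝ k x).det :=
      ContinuousLinearMap.continuous_det.comp (by fun_prop)
    exact h2.continuousOn.integrableOn_compact hB
  have hexp : ∀ k : (Fin r → ℝ) → (Fin r → ℝ), (fun x => (1 + fderiv ℝ k x).det)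
      = fun x => ∑ t ∈ s, c t * (1 + t • fderiv ℝ k x).det := fun k => funext fun x => hsum _
  rw [hexp k, hexp k', integral_finsetSum s fun t _ => (hint k hk t).const_mul (c t),
    integral_finsetSum s fun t _ => (hint k' hk' t).const_mul (c t)]
  refine Finset.sum_congr rfl fun t ht => ?_
  rw [integral_const_mul, integral_const_mul, hvol k hk hL₁ t ht, hvol k' hk' hL₂ t ht,
    himage t ht]

/-- A smooth step function in each coordinate. -/
noncomputable def stepMap (r : ℕ) (y : Fin r → ℝ) : Fin r → ℝ :=
  fun i => Real.smoothTransition (y i)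

theorem contDiff_stepMap (r : ℕ) : ContDiff ℝ 1 (stepMap r) :=
  contDiff_pi.2 fun i => Real.smoothTransition.contDiff.comp
    (contDiff_apply ℝ ℝ i : ContDiff ℝ 1 fun f : Fin r → ℝ => f i)

theorem det_fderiv_stepMap {r : ℕ} (y : Fin r → ℝ) :
    (fderiv ℝ (stepMap r) y).det = ∏ i, deriv Real.smoothTransition (y i) := by
  have h1 : HasFDerivAt (stepMap r) (ContinuousLinearMap.pi fun i =>
      (deriv Real.smoothTransition (y i)) •
        ContinuousLinearMap.proj (R := ℝ) (φ := fun _ => ℝ) i) y := by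
    refine hasFDerivAt_pi.2 fun i => ?_
    have h2 : HasDerivAt Real.smoothTransition (deriv Real.smoothTransition (y i)) (y i) :=
      (Real.smoothTransition.contDiff (n := 1)).differentiable one_ne_zero _ |>.hasDerivAt
    exact h2.comp_hasFDerivAt y (hasFDerivAt_apply i y)
  rw [h1.fderiv, ContinuousLinearMap.det, ← LinearMap.det_toMatrix', ← Matrix.det_diagonal]
  congr 1
  ext i j
  simp [LinearMap.toMatrix'_apply, Matrix.diagonal_apply, Pi.single_apply]

theorem deriv_smoothTransition_eq_zero {t : ℝ} (ht : t ∉ Set.Ioo (0 : ℝ) 1) :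
    deriv Real.smoothTransition t = 0 := by
  rw [Set.mem_Ioo, not_and_or, not_lt, not_lt] at ht
  rcases ht with ht | ht
  · refine IsLocalMin.deriv_eq_zero (Eventually.of_forall fun x => ?_)
    rw [Real.smoothTransition.zero_of_nonpos ht]
    exact Real.smoothTransition.nonneg x
  · refine IsLocalMax.deriv_eq_zero (Eventually.of_forall fun x => ?_)
    rw [Real.smoothTransition.one_of_one_le ht]
    exact Real.smoothTransition.le_one x

theorem exists_deriv_smoothTransition_pos :
    ∃ t ∈ Set.Ioo (0 : ℝ) 1, 0 < deriv Real.smoothTransition t := by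
  obtain ⟨t, ht, h⟩ := exists_deriv_eq_slope Real.smoothTransition zero_lt_one
    Real.smoothTransition.continuous.continuousOn
    ((Real.smoothTransition.contDiff (n := 1)).differentiable one_ne_zero).differentiableOn
  refine ⟨t, ht, ?_⟩
  rw [h, Real.smoothTransition.zero, Real.smoothTransition.one]
  norm_num

theorem setIntegral_det_fderiv_stepMap_pos (r : ℕ) :
    0 < ∫ y in Metric.closedBall (0 : Fin r → ℝ) 3, (fderiv ℝ (stepMap r) y).det := by
  have hcont : Continuous fun y => (fderiv ℝ (stepMap r) y).det :=
    ContinuousLinearMap.continuous_det.comp ((contDiff_stepMap r).continuous_fderiv one_ne_zero)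
  have hnonneg : ∀ y, 0 ≤ (fderiv ℝ (stepMap r) y).det := fun y => by
    rw [det_fderiv_stepMap]
    exact Finset.prod_nonneg fun i _ => Real.smoothTransition.monotone.deriv_nonneg
  rw [setIntegral_pos_iff_support_of_nonneg_ae (Eventually.of_forall hnonneg)
    (hcont.continuousOn.integrableOn_compact (isCompact_closedBall _ _))]
  obtain ⟨t, ht, htpos⟩ := exists_deriv_smoothTransition_pos
  have hopen : IsOpen ((Function.support fun y => (fderiv ℝ (stepMap r) y).det) ∩
      Metric.ball (0 : Fin r → ℝ) 3) := hcont.isOpen_support.inter Metric.isOpen_ball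
  refine (hopen.measure_pos volume ⟨fun _ => t, ?_, ?_⟩).trans_le
    (measure_mono (Set.inter_subset_inter_right _ Metric.ball_subset_closedBall))
  · rw [Function.mem_support, det_fderiv_stepMap]
    exact (Finset.prod_pos fun i _ => htpos).ne'
  · rw [mem_ball_zero_iff, pi_norm_lt_iff (by norm_num)]
    intro i
    rw [Real.norm_eq_abs, abs_of_pos ht.1]
    linarith [ht.2]

/-- A smooth map which is the identity far away takes some value in the open unit cube at a point
where its Jacobian does not vanish. Composed with the step function, it would otherwise have
vanishing Jacobian everywhere, while the integral of the Jacobian is that of the step function. -/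
theorem exists_det_fderiv_ne_zero {r : ℕ} {g : (Fin r → ℝ) → (Fin r → ℝ)} (hg : ContDiff ℝ 1 g)
    (hid : ∀ x ∉ Metric.closedBall (0 : Fin r → ℝ) 3, g x = x) :
    ∃ x, (∀ i, g x i ∈ Set.Ioo (0 : ℝ) 1) ∧ (fderiv ℝ g x).det ≠ 0 := by
  by_contra! hcon
  -- cut off outside a larger ball, to have compactly supported perturbations of the identity
  let χ : ContDiffBump (0 : Fin r → ℝ) := ⟨4, 5, by norm_num, by norm_num⟩
  let k : (Fin r → ℝ) → (Fin r → ℝ) := fun x => χ x • (stepMap r x - x)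
  let k' : (Fin r → ℝ) → (Fin r → ℝ) := fun x => χ x • (stepMap r (g x) - x)
  have hk : ContDiff ℝ 1 k := χ.contDiff.smul ((contDiff_stepMap r).sub contDiff_id)
  have hk' : ContDiff ℝ 1 k' := χ.contDiff.smul (((contDiff_stepMap r).comp hg).sub contDiff_id)
  have hkc : HasCompactSupport k := χ.hasCompactSupport.smul_right
  have hkc' : HasCompactSupport k' := χ.hasCompactSupport.smul_right
  have hfd : ∀ (f : (Fin r → ℝ) → (Fin r → ℝ)), ContDiff ℝ 1 f → ∀ x ∈ Metric.closedBall 0 3,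
      1 + fderiv ℝ (fun x => χ x • (f x - x)) x = fderiv ℝ f x := by
    intro f hf x hx
    have h1 : (fun x => χ x • (f x - x)) =ᶠ[𝓝 x] fun x => f x - x := by
      have : Metric.ball (0 : Fin r → ℝ) 4 ∈ 𝓝 x :=
        Metric.isOpen_ball.mem_nhds (Metric.closedBall_subset_ball (by norm_num) hx)
      filter_upwards [this] with z hz
      rw [χ.one_of_mem_closedBall (Metric.ball_subset_closedBall hz), one_smul]
    have h2 : HasFDerivAt (fun x => f x - x) (fderiv ℝ f x - ContinuousLinearMap.id ℝ _) x :=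
      (hf.differentiable one_ne_zero x).hasFDerivAt.sub (hasFDerivAt_id x)
    rw [h1.fderiv_eq, h2.fderiv]
    exact add_sub_cancel _ _
  have h := setIntegral_det_one_add_fderiv_congr hk hk' hkc hkc'
    (isCompact_closedBall (0 : Fin r → ℝ) 3) fun x hx => by simp only [k, k', hid x hx]
  have h1 : ∫ x in Metric.closedBall (0 : Fin r → ℝ) 3, (1 + fderiv ℝ k x).det
      = ∫ x in Metric.closedBall (0 : Fin r → ℝ) 3, (fderiv ℝ (stepMap r) x).det :=
    setIntegral_congr_fun measurableSet_closedBall fun x hx => by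
      simp only [k]; rw [hfd _ (contDiff_stepMap r) x hx]
  have h2 : ∫ x in Metric.closedBall (0 : Fin r → ℝ) 3, (1 + fderiv ℝ k' x).det = 0 := by
    refine setIntegral_eq_zero_of_forall_eq_zero fun x hx => ?_
    have h3 := hfd (fun x => stepMap r (g x)) ((contDiff_stepMap r).comp hg) x hx
    simp only [k']
    rw [h3]
    have h4 : fderiv ℝ (fun x => stepMap r (g x)) x
        = (fderiv ℝ (stepMap r) (g x)).comp (fderiv ℝ g x) :=
      fderiv_comp x ((contDiff_stepMap r).differentiable one_ne_zero _)
        (hg.differentiable one_ne_zero x)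
    rw [h4]
    have h5 : ((fderiv ℝ (stepMap r) (g x)).comp (fderiv ℝ g x)).det
        = (fderiv ℝ (stepMap r) (g x)).det * (fderiv ℝ g x).det :=
      LinearMap.det_comp _ _
    rw [h5]
    by_cases hx : ∀ i, g x i ∈ Set.Ioo (0 : ℝ) 1
    · rw [hcon x hx, mul_zero]
    · push Not at hx
      obtain ⟨i, hi⟩ := hx
      rw [det_fderiv_stepMap, Finset.prod_eq_zero (Finset.mem_univ i)
        (deriv_smoothTransition_eq_zero hi), zero_mul]
  have := setIntegral_det_fderiv_stepMap_pos r
  rw [← h1, h, h2] at this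
  exact lt_irrefl _ this

/-! ### The covering dimension of a space containing a cube -/

/-- If at a point at most `r` of the functions of a partition of unity are nonzero, then
`∑ φ i • c i` has vanishing Jacobian there, in dimension `r`: its differential takes values in the
span of `r - 1` differences `c i - c j`. -/
theorem det_fderiv_sum_smul_eq_zero {ι : Type*} [Fintype ι] {r : ℕ} (φ : ι → (Fin r → ℝ) → ℝ)
    (hφ : ∀ i, ContDiff ℝ 1 (φ i)) (hnonneg : ∀ i x, 0 ≤ φ i x) (hsum : ∀ x, ∑ i, φ i x = 1)
    (c : ι → Fin r → ℝ) (x : Fin r → ℝ) (hx : {i | φ i x ≠ 0}.encard ≤ r) :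
    (fderiv ℝ (fun x => ∑ i, φ i x • c i) x).det = 0 := by
  classical
  set S : Finset ι := Finset.univ.filter fun i => φ i x ≠ 0 with hS
  have hScard : S.card ≤ r := by
    have : {i | φ i x ≠ 0} = (S : Set ι) := by ext i; simp [hS]
    rw [this, Set.encard_coe_eq_coe_finsetCard] at hx
    exact_mod_cast hx
  have hd : ∀ i, HasFDerivAt (φ i) (fderiv ℝ (φ i) x) x := fun i =>
    ((hφ i).differentiable one_ne_zero x).hasFDerivAt
  have hzero : ∀ i ∉ S, fderiv ℝ (φ i) x = 0 := by
    intro i hi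
    have hi0 : φ i x = 0 := by simpa [hS] using hi
    exact IsLocalMin.fderiv_eq_zero (Eventually.of_forall fun y => by rw [hi0]; exact hnonneg i y)
  have hsumd : ∑ i, fderiv ℝ (φ i) x = 0 := by
    have h1 : HasFDerivAt (fun y => ∑ i, φ i y) (∑ i, fderiv ℝ (φ i) x) x :=
      HasFDerivAt.fun_sum fun i _ => hd i
    simp only [hsum] at h1
    exact h1.unique (hasFDerivAt_const _ _)
  have hder : fderiv ℝ (fun x => ∑ i, φ i x • c i) x
      = ∑ i, (fderiv ℝ (φ i) x).smulRight (c i) :=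
    (HasFDerivAt.fun_sum fun i _ => (hd i).smul_const (c i)).fderiv
  obtain ⟨i₀, hi₀⟩ : S.Nonempty := by
    rw [Finset.nonempty_iff_ne_empty]
    intro hempty
    have : ∑ i, φ i x = 0 := Finset.sum_eq_zero fun i _ => by
      by_contra h
      have : i ∈ S := by simpa [hS] using h
      rw [hempty] at this
      simp at this
    rw [hsum] at this
    exact one_ne_zero this
  set Q : Submodule ℝ (Fin r → ℝ) :=
    Submodule.span ℝ ((S.erase i₀).image fun i => c i - c i₀ : Finset (Fin r → ℝ)) with hQ
  have hQdim : Module.finrank ℝ Q < r := by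
    have h1 := finrank_span_finset_le_card (R := ℝ) ((S.erase i₀).image fun i => c i - c i₀)
    have h2 := Finset.card_image_le (s := S.erase i₀) (f := fun i => c i - c i₀)
    rw [Finset.card_erase_of_mem hi₀] at h2
    have h3 : 0 < S.card := Finset.card_pos.2 ⟨i₀, hi₀⟩
    have h4 : Module.finrank ℝ Q ≤ _ := h1
    omega
  have hrange : ∀ v, fderiv ℝ (fun x => ∑ i, φ i x • c i) x v ∈ Q := by
    intro v
    have h1 : fderiv ℝ (fun x => ∑ i, φ i x • c i) x v
        = ∑ i, fderiv ℝ (φ i) x v • (c i - c i₀) := by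
      have h2 : ∑ i, fderiv ℝ (φ i) x v = 0 := by
        have := congrArg (fun T => T v) hsumd
        simpa using this
      simp only [smul_sub, Finset.sum_sub_distrib, ← Finset.sum_smul, h2, zero_smul, sub_zero]
      rw [hder]
      simp
    rw [h1]
    refine Submodule.sum_mem _ fun i _ => ?_
    by_cases hiS : i ∈ S
    · by_cases hii : i = i₀
      · simp [hii]
      · refine Submodule.smul_mem _ _ (Submodule.subset_span ?_)
        exact Finset.mem_coe.2 (Finset.mem_image_of_mem _ (Finset.mem_erase.2 ⟨hii, hiS⟩))
    · simp [hzero i hiS]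
  by_contra hdet
  have hsurj : LinearMap.range (fderiv ℝ (fun x => ∑ i, φ i x • c i) x).toLinearMap = ⊤ :=
    LinearMap.range_eq_top.2 (LinearMap.equivOfDetNeZero _ hdet).surjective
  have hle : (⊤ : Submodule ℝ (Fin r → ℝ)) ≤ Q := by
    rw [← hsurj]
    rintro _ ⟨v, rfl⟩
    exact hrange v
  have h5 := Submodule.finrank_mono hle
  rw [finrank_top, Module.finrank_fin_fun] at h5
  omega

/-- Lebesgue's covering theorem: a Hausdorff space in which the cube of dimension `d + 1` embeds
has covering dimension greater than `d`. A fine enough cover of order at most `d + 1` would give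
a map close to the identity of the cube, with vanishing Jacobian. -/
theorem not_hasCoveringDimLE_of_injOn {X : Type*} [TopologicalSpace X] [T2Space X] {d : ℕ}
    (ψ : (Fin (d + 1) → ℝ) → X) (hψ : Continuous ψ)
    (hinj : Set.InjOn ψ (Metric.closedBall 0 3)) : ¬ HasCoveringDimLE X d := by
  classical
  intro hdim
  set K : Set (Fin (d + 1) → ℝ) := Metric.closedBall 0 3 with hK
  have hKc : IsCompact K := isCompact_closedBall _ _
  obtain ⟨t, -, htfin, htK⟩ := hKc.finite_cover_balls (e := 1 / 2) (by norm_num)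
  -- the open set `u c` meets the embedded cube within the image of the ball around `c`
  let u : (Fin (d + 1) → ℝ) → Set X := fun c => (ψ '' (K \ Metric.ball c (1 / 2)))ᶜ
  have huopen : ∀ c, IsOpen (u c) := fun c =>
    ((hKc.diff Metric.isOpen_ball).image hψ).isClosed.isOpen_compl
  have hu : ∀ c, ∀ x ∈ K, ψ x ∈ u c → x ∈ Metric.ball c (1 / 2) := by
    intro c x hx hxu
    by_contra h
    exact hxu ⟨x, ⟨hx, h⟩, rfl⟩
  have hucover : ⋃₀ (u '' t) = Set.univ := by
    rw [Set.eq_univ_iff_forall]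
    intro y
    by_contra hy
    simp only [Set.sUnion_image, Set.mem_iUnion₂, not_exists] at hy
    have hy' : ∀ c ∈ t, ∃ x ∈ K, x ∉ Metric.ball c (1 / 2) ∧ ψ x = y := by
      intro c hc
      have := hy c hc
      rw [Set.mem_compl_iff, not_not] at this
      obtain ⟨x, ⟨hx1, hx2⟩, hx3⟩ := this
      exact ⟨x, hx1, hx2, hx3⟩
    obtain ⟨c₀, hc₀, -⟩ := Set.mem_iUnion₂.1 (htK (Metric.mem_closedBall_self (by norm_num)))
    obtain ⟨x, hxK, -, hxy⟩ := hy' c₀ hc₀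
    obtain ⟨c, hc, hxc⟩ := Set.mem_iUnion₂.1 (htK hxK)
    obtain ⟨x', hx'K, hx'c, hx'y⟩ := hy' c hc
    exact hx'c (hinj hx'K hxK (hx'y.trans hxy.symm) ▸ hxc)
  obtain ⟨V, hVfin, hVopen, hVcover, hVref, hVord⟩ := hdim (u '' t) (htfin.image u)
    (by rintro _ ⟨c, -, rfl⟩; exact huopen c) hucover
  have hcenter : ∀ v : V, ∃ c, (v : Set X) ⊆ u c := by
    intro v
    obtain ⟨_, ⟨c, -, rfl⟩, hc⟩ := hVref v v.2
    exact ⟨c, hc⟩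
  choose c hc using hcenter
  have : Fintype V := hVfin.fintype
  -- pull the refinement back, and move every point to a convex combination of nearby centres
  obtain ⟨φ, hφ⟩ := SmoothPartitionOfUnity.exists_isSubordinate
    (modelWithCornersSelf ℝ (Fin (d + 1) → ℝ)) (isClosed_univ (X := Fin (d + 1) → ℝ))
    (fun v : V => ψ ⁻¹' (v : Set X)) (fun v => (hVopen v v.2).preimage hψ) (by
      intro x _
      have : ψ x ∈ ⋃₀ V := by rw [hVcover]; trivial
      obtain ⟨v, hv, hxv⟩ := this
      exact Set.mem_iUnion.2 ⟨⟨v, hv⟩, hxv⟩)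
  have hφsmooth : ∀ v, ContDiff ℝ 1 (φ v) := fun v =>
    (contMDiff_iff_contDiff.1 (φ v).contMDiff).of_le (by exact_mod_cast le_top)
  have hφsum : ∀ x, ∑ v, φ v x = 1 := fun x => by
    rw [← finsum_eq_sum_of_fintype]
    exact φ.sum_eq_one (Set.mem_univ x)
  have hφmem : ∀ v x, φ v x ≠ 0 → ψ x ∈ (v : Set X) := fun v x h =>
    hφ v (subset_tsupport _ h)
  have hord : ∀ x, {v : V | φ v x ≠ 0}.encard ≤ ((d + 1 : ℕ) : ℕ∞) := by
    intro x
    have h1 : ((↑) : V → Set X) '' {v : V | φ v x ≠ 0} ⊆ {v ∈ V | ψ x ∈ v} := by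
      rintro _ ⟨v, hv, rfl⟩
      exact ⟨v.2, hφmem v x hv⟩
    rw [← Subtype.val_injective.encard_image]
    exact (Set.encard_le_encard h1).trans (by exact_mod_cast hVord (ψ x))
  set f : (Fin (d + 1) → ℝ) → (Fin (d + 1) → ℝ) := fun x => ∑ v, φ v x • c v with hf
  have hfdet : ∀ x, (fderiv ℝ f x).det = 0 := fun x =>
    det_fderiv_sum_smul_eq_zero (fun v => φ v) hφsmooth (fun v x => φ.nonneg v x) hφsum c x (hord x)
  have hfsmooth : ContDiff ℝ 1 f := ContDiff.sum fun v _ => (hφsmooth v).smul contDiff_const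
  have hfclose : ∀ x ∈ K, ‖f x - x‖ ≤ 1 / 2 := by
    intro x hx
    have h1 : f x - x = ∑ v, φ v x • (c v - x) := by
      simp only [smul_sub, Finset.sum_sub_distrib, ← Finset.sum_smul, hφsum, one_smul, hf]
    rw [h1]
    calc ‖∑ v, φ v x • (c v - x)‖ ≤ ∑ v, φ v x * (1 / 2) := by
          refine norm_sum_le_of_le _ fun v _ => ?_
          rw [norm_smul, Real.norm_of_nonneg (φ.nonneg v x)]
          by_cases h0 : φ v x = 0
          · simp [h0]
          · have h2 := hu (c v) x hx (hc v (hφmem v x h0))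
            rw [Metric.mem_ball', dist_eq_norm] at h2
            exact mul_le_mul_of_nonneg_left h2.le (φ.nonneg v x)
      _ = 1 / 2 := by rw [← Finset.sum_mul, hφsum, one_mul]
  -- `g` is `f` on the ball of radius `2` and the identity outside that of radius `5 / 2`;
  -- as it moves points by at most `1 / 2`, it reaches the unit cube only from the former
  let β : ContDiffBump (0 : Fin (d + 1) → ℝ) := ⟨2, 5 / 2, by norm_num, by norm_num⟩
  set g : (Fin (d + 1) → ℝ) → (Fin (d + 1) → ℝ) := fun x => x + β x • (f x - x) with hg
  have hβ0 : ∀ x, x ∉ K → β x = 0 := fun x hx => β.zero_of_le_dist (by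
    rw [hK, Metric.mem_closedBall, not_le] at hx
    change 5 / 2 ≤ dist x 0
    linarith)
  have hgsmooth : ContDiff ℝ 1 g := contDiff_id.add (β.contDiff.smul (hfsmooth.sub contDiff_id))
  obtain ⟨x, hx, hxdet⟩ := exists_det_fderiv_ne_zero hgsmooth
    fun x hx => by simp [hg, hβ0 x hx]
  apply hxdet
  have hgx : ‖g x‖ ≤ 1 := (pi_norm_le_iff_of_nonneg zero_le_one).2 fun i => by
    rw [Real.norm_eq_abs, abs_of_pos (hx i).1]
    exact (hx i).2.le
  have hclose : ‖g x - x‖ ≤ 1 / 2 := by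
    rw [hg, add_sub_cancel_left, norm_smul, Real.norm_of_nonneg β.nonneg]
    by_cases hxK : x ∈ K
    · exact (mul_le_of_le_one_left (norm_nonneg _) β.le_one).trans (hfclose x hxK)
    · rw [hβ0 x hxK, zero_mul]; norm_num
  have hxball : x ∈ Metric.ball (0 : Fin (d + 1) → ℝ) 2 := by
    rw [mem_ball_zero_iff]
    have := norm_sub_norm_le x (g x)
    rw [norm_sub_rev] at this
    linarith
  have heq : g =ᶠ[𝓝 x] f := by
    filter_upwards [Metric.isOpen_ball.mem_nhds hxball] with z hz
    simp only [hg]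
    rw [β.one_of_mem_closedBall (Metric.ball_subset_closedBall hz), one_smul, add_sub_cancel]
  rw [heq.fderiv_eq]
  exact hfdet x

theorem hasCoveringDimLE_of_coveringDim_eq {X : Type*} [TopologicalSpace X] {d : ℕ}
    (h : coveringDim X = (d : ℕ∞)) : HasCoveringDimLE X d := by
  by_contra hd
  have hle : ((d + 1 : ℕ) : ℕ∞) ≤ coveringDim X := by
    refine le_iInf₂ fun n hn => ?_
    have hdn : d < n := by
      by_contra hnd
      push Not at hnd
      refine hd fun U h1 h2 h3 => ?_
      obtain ⟨V, hV1, hV2, hV3, hV4, hV5⟩ := hn U h1 h2 h3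
      refine ⟨V, hV1, hV2, hV3, hV4, fun x => (hV5 x).trans ?_⟩
      gcongr
    exact_mod_cast hdn
  rw [h] at hle
  have : d + 1 ≤ d := by exact_mod_cast hle
  omega

/-! ### The rank of the character group -/

section Rationalization

variable {A : Type*} [AddCommGroup A]

/-- The canonical map of an abelian group to its rationalization. -/
noncomputable def rationalize (A : Type*) [AddCommGroup A] : A →ₗ[ℤ] TensorProduct ℤ ℚ A :=
  TensorProduct.mk ℤ ℚ A 1

theorem rationalize_injective (hA : ∀ (n : ℤ) (a : A), n ≠ 0 → n • a = 0 → a = 0) :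
    Function.Injective (rationalize A) := by
  rw [injective_iff_map_eq_zero]
  intro a ha
  have h : TensorProduct.mk ℤ ℚ A 1 a = TensorProduct.mk ℤ ℚ A 1 0 := by rw [map_zero]; exact ha
  obtain ⟨c, hc⟩ := IsLocalizedModule.exists_of_eq (S := nonZeroDivisors ℤ) h
  rw [smul_zero] at hc
  exact hA c a (nonZeroDivisors.coe_ne_zero c) hc

theorem exists_zsmul_eq_rationalize (v : TensorProduct ℤ ℚ A) :
    ∃ (n : ℤ) (a : A), n ≠ 0 ∧ n • v = rationalize A a := by
  obtain ⟨⟨a, n⟩, h⟩ := IsLocalizedModule.surj (nonZeroDivisors ℤ) (TensorProduct.mk ℤ ℚ A 1) v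
  exact ⟨n, a, nonZeroDivisors.coe_ne_zero n, h⟩

theorem zsmul_eq_zero_imp {V : Type*} [AddCommGroup V] [Module ℚ V] {n : ℤ} (hn : n ≠ 0) {v : V}
    (h : n • v = 0) : v = 0 := by
  rw [← Int.cast_smul_eq_zsmul ℚ] at h
  exact (smul_eq_zero.1 h).resolve_left (by exact_mod_cast hn)

/-- Finitely many vectors have a common denominator. -/
theorem exists_zsmul_eq_rationalize_of_finite {ι : Type*} [Fintype ι]
    (v : ι → TensorProduct ℤ ℚ A) :
    ∃ (n : ℤ) (a : ι → A), n ≠ 0 ∧ ∀ i, n • v i = rationalize A (a i) := by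
  classical
  choose n a hn h using fun i => exists_zsmul_eq_rationalize (v i)
  refine ⟨∏ i, n i, fun i => (∏ j ∈ Finset.univ.erase i, n j) • a i,
    Finset.prod_ne_zero_iff.2 fun i _ => hn i, fun i => ?_⟩
  rw [map_zsmul, ← h, smul_smul, Finset.prod_erase_mul _ _ (Finset.mem_univ i)]

theorem rationalize_pow_apply (φ : Module.End ℤ A) (n : ℕ) (a : A) :
    rationalize A ((φ ^ n) a) = ((φ.baseChange ℚ : Module.End ℚ (TensorProduct ℤ ℚ A)) ^ n)
      (rationalize A a) := by
  induction n generalizing a with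
  | zero => rfl
  | succ n ih =>
    rw [pow_succ, pow_succ, Module.End.mul_apply, Module.End.mul_apply, ih]
    rfl

theorem baseChange_injective {φ : Module.End ℤ A} (hφ : Function.Injective φ)
    (hA : ∀ (n : ℤ) (a : A), n ≠ 0 → n • a = 0 → a = 0) :
    Function.Injective (φ.baseChange ℚ : Module.End ℚ (TensorProduct ℤ ℚ A)) := by
  rw [injective_iff_map_eq_zero]
  intro v hv
  obtain ⟨n, a, hn, h⟩ := exists_zsmul_eq_rationalize v
  have h1 : rationalize A (φ a) = 0 := by
    have := rationalize_pow_apply φ 1 a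
    rw [pow_one, pow_one] at this
    rw [this, ← h, map_zsmul, hv, smul_zero]
  rw [map_eq_zero_iff _ (rationalize_injective hA), map_eq_zero_iff _ hφ] at h1
  rw [h1, map_zero] at h
  exact zsmul_eq_zero_imp hn h

/-- If a torsion-free group has rank at most `d`, a nontrivial tuple with infinitely many relations
`∑ i, φ i ^ n (a i) = 0` can be replaced by one supported on `d + 1` indices. -/
theorem exists_infinite_relations_of_infinite_relations {ι : Type*} [Fintype ι] {d : ℕ}
    (hA : ∀ (n : ℤ) (a : A), n ≠ 0 → n • a = 0 → a = 0)
    [FiniteDimensional ℚ (TensorProduct ℤ ℚ A)]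
    (hd : Module.finrank ℚ (TensorProduct ℤ ℚ A) ≤ d) (hι : d < Fintype.card ι)
    (φ : ι → Module.End ℤ A) (hφ : ∀ i, Function.Injective (φ i)) (a : ι → A) (ha : a ≠ 0)
    (hinf : {n : ℕ | ∑ i, (φ i ^ n) (a i) = 0}.Infinite) :
    ∃ E : Finset ι, E.card = d + 1 ∧ ∃ c : ι → A, (∃ i ∈ E, c i ≠ 0) ∧
      {n : ℕ | ∑ i ∈ E, (φ i ^ n) (c i) = 0}.Infinite := by
  classical
  let V := TensorProduct ℤ ℚ A
  have hinj := rationalize_injective hA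
  let T : ι → Module.End ℚ V := fun i => (φ i).baseChange ℚ
  have hT : ∀ i, Function.Injective (T i) := fun i => baseChange_injective (hφ i) hA
  have hTinj : Function.Injective (diagonalEnd T) := fun v w h => by
    ext1 i
    exact hT i (congrFun h i)
  let L : (ι → V) →ₗ[ℚ] V := ∑ i, LinearMap.proj i
  have hL : ∀ w, L w = ∑ i, w i := fun w => by simp [L]
  have hLT : ∀ n w, L ((diagonalEnd T ^ n) w) = ∑ i, (T i ^ n) (w i) := fun n w => by
    rw [hL]
    exact Finset.sum_congr rfl fun i _ => diagonalEnd_pow_apply T n w i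
  have hinf' : {n : ℕ | L ((diagonalEnd T ^ n) fun i => rationalize A (a i)) = 0}.Infinite := by
    refine hinf.mono fun n hn => ?_
    rw [Set.mem_ofPred_eq] at hn ⊢
    rw [hLT, ← map_zero (rationalize A), ← hn, map_sum]
    exact Finset.sum_congr rfl fun i _ => (rationalize_pow_apply (φ i) n (a i)).symm
  obtain ⟨q, r, hq, h⟩ := exists_forall_linearMap_pow_eq_zero (diagonalEnd T) hTinj L _ hinf'
  obtain ⟨i₀, hi₀⟩ := Function.ne_iff.1 ha
  have hb : (fun i => (T i ^ r) (rationalize A (a i))) ≠ 0 := by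
    refine Function.ne_iff.2 ⟨i₀, ?_⟩
    rw [Pi.zero_apply, Ne, Module.End.pow_apply]
    intro h0
    refine hi₀ (hinj ((hT i₀).iterate r ?_))
    rw [h0, Pi.zero_apply, map_zero, iterate_map_zero]
  obtain ⟨E, hE, c, ⟨i, hiE, hci⟩, hc⟩ := exists_shorter_relation (fun i => T i ^ q) hd hι _ hb
    (fun k => by
      rw [← h k, hLT]
      refine Finset.sum_congr rfl fun i _ => ?_
      rw [add_comm, pow_add, pow_mul, Module.End.mul_apply])
  obtain ⟨N, c', hN, hc'⟩ := exists_zsmul_eq_rationalize_of_finite c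
  refine ⟨E, hE, c', ⟨i, hiE, fun h0 => hci ?_⟩, ?_⟩
  · have := hc' i
    rw [h0, map_zero] at this
    exact zsmul_eq_zero_imp hN this
  · refine (Set.infinite_range_of_injective (f := fun k : ℕ => q * k)
      fun k l hkl => Nat.eq_of_mul_eq_mul_left hq hkl).mono ?_
    rintro _ ⟨k, rfl⟩
    rw [Set.mem_ofPred_eq]
    apply hinj
    rw [map_zero, map_sum]
    have h1 : ∀ i, rationalize A ((φ i ^ (q * k)) (c' i)) = N • (((T i) ^ q) ^ k) (c i) := by
      intro i
      rw [rationalize_pow_apply, ← hc', map_zsmul, pow_mul]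
    simp only [h1]
    rw [← Finset.smul_sum, hc, smul_zero]

end Rationalization

section Rank

variable {X : Type*} [CommGroup X] [TopologicalSpace X] [IsTopologicalGroup X]
  [CompactSpace X] [T2Space X] [ConnectedSpace X] [MeasurableSpace X] [BorelSpace X]
  (m : Measure X) [m.IsHaarMeasure] [m.Regular] [IsProbabilityMeasure m]

/-- The character group of a connected group is torsion free, since a connected set of roots of
unity is a point. -/
theorem zsmul_character_eq_zero_imp (n : ℤ) (a : Additive (X →ₜ* Circle)) (hn : n ≠ 0)
    (h : n • a = 0) : a = 0 := by
  let χ : X →ₜ* Circle := a.toMul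
  have hχ : ∀ x, (χ x) ^ n.natAbs = 1 := by
    intro x
    have h1 : (χ x) ^ n = 1 := by
      have h2 : χ ^ n = 1 := h
      let ev : (X →ₜ* Circle) →* Circle :=
        { toFun := fun ξ => ξ x, map_one' := rfl, map_mul' := fun _ _ => rfl }
      have h3 : ev (χ ^ n) = ev 1 := congrArg ev h2
      rwa [map_zpow, map_one] at h3
    rcases Int.natAbs_eq n with h2 | h2
    · rw [h2, zpow_natCast] at h1; exact h1
    · rw [h2, zpow_neg, zpow_natCast, inv_eq_one] at h1; exact h1
  have hfin : (Set.range χ).Finite := by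
    have h1 : {z : ℂ | z ^ n.natAbs = 1}.Finite := by
      refine ((Polynomial.nthRoots n.natAbs (1 : ℂ)).toFinset.finite_toSet).subset fun z hz => ?_
      rw [Finset.mem_coe, Multiset.mem_toFinset, Polynomial.mem_nthRoots (Int.natAbs_pos.2 hn)]
      exact hz
    refine Set.Finite.subset (h1.preimage (f := ((↑) : Circle → ℂ)) Subtype.val_injective.injOn) ?_
    rintro _ ⟨x, rfl⟩
    change ((χ x : Circle) : ℂ) ^ n.natAbs = 1
    rw [← Circle.coe_pow, hχ, Circle.coe_one]
  have hsub : (Set.range χ).Subsingleton := by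
    by_contra h
    exact (isPreconnected_range χ.continuous_toFun).infinite_of_nontrivial
      (Set.not_subsingleton_iff.1 h) hfin
  refine (ContinuousMonoidHom.ext fun x => ?_ : χ = 1)
  have := hsub ⟨x, rfl⟩ ⟨1, rfl⟩
  rw [this, map_one]
  rfl

include m in
/-- A linear map from the rationalized character group to a space `Fin r → ℚ` gives a continuous
map `ψ` of `Fin r → ℝ` to the group, a combination of one-parameter subgroups. -/
theorem exists_continuous_forall_character_eq {r : ℕ}
    (g : TensorProduct ℤ ℚ (Additive (X →ₜ* Circle)) →ₗ[ℚ] (Fin r → ℚ)) :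
    ∃ ψ : (Fin r → ℝ) → X, Continuous ψ ∧ ∀ s (χ : X →ₜ* Circle),
      χ (ψ s) = Circle.exp (∑ i, s i * (g (rationalize _ (Additive.ofMul χ)) i : ℝ)) := by
  have hex : ∀ s : Fin r → ℝ, ∃ x : X, ∀ χ : X →ₜ* Circle,
      χ x = Circle.exp (∑ i, s i * (g (rationalize _ (Additive.ofMul χ)) i : ℝ)) := by
    intro s
    exact exists_eval_eq m
      { toFun := fun χ => Circle.exp (∑ i, s i * (g (rationalize _ (Additive.ofMul χ)) i : ℝ))
        map_one' := by simp
        map_mul' := fun χ ξ => by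
          rw [ofMul_mul, map_add, map_add, ← Circle.exp_add, ← Finset.sum_add_distrib]
          congr 1
          refine Finset.sum_congr rfl fun i _ => ?_
          rw [Pi.add_apply]
          push_cast
          ring }
  choose ψ hψ using hex
  refine ⟨ψ, ?_, hψ⟩
  -- the characters embed the group into a product of circles
  let e : X → (X →ₜ* Circle) → Circle := fun x χ => χ x
  have he : Continuous e := continuous_pi fun χ => χ.continuous_toFun
  have hinj : Function.Injective e := by
    intro x y hxy
    by_contra hne
    obtain ⟨χ, hχ⟩ := exists_character_ne_one m (x := x / y) (by rwa [Ne, div_eq_one])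
    apply hχ
    rw [map_div, div_eq_one]
    exact congrFun hxy χ
  rw [(he.isClosedEmbedding hinj).isEmbedding.continuous_iff]
  refine continuous_pi fun χ => ?_
  simp only [Function.comp_apply, e, hψ]
  fun_prop

include m in
/-- The rank of the character group is at most the covering dimension: `d + 1` independent
characters would give an embedding of a cube of dimension `d + 1`. -/
theorem rank_rationalized_characters_le {d : ℕ} (hdim : HasCoveringDimLE X d) :
    Module.rank ℚ (TensorProduct ℤ ℚ (Additive (X →ₜ* Circle))) ≤ d := by
  by_contra hlt
  push Not at hlt
  have hle : ((d + 1 : ℕ) : Cardinal) ≤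
      Module.rank ℚ (TensorProduct ℤ ℚ (Additive (X →ₜ* Circle))) := by
    rw [Nat.cast_succ, ← Cardinal.succ_natCast]
    exact Order.succ_le_of_lt hlt
  obtain ⟨v, hv⟩ := exists_linearIndependent_of_le_rank hle
  obtain ⟨N, a, hN, ha⟩ := exists_zsmul_eq_rationalize_of_finite v
  obtain ⟨g, hg⟩ := LinearMap.exists_leftInverse_of_injective
    (Fintype.linearCombination ℚ v) (LinearMap.ker_eq_bot.2
      (linearIndependent_iff_injective_fintypeLinearCombination.1 hv))
  have hgv : ∀ j, g (v j) = Pi.single j 1 := by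
    intro j
    have := LinearMap.congr_fun hg (Pi.single j 1)
    simpa using this
  -- rescale so that the functionals take the values `0` and `1` on the chosen characters
  obtain ⟨ψ, hψ, hψχ⟩ := exists_continuous_forall_character_eq m ((N : ℚ)⁻¹ • g)
  have hcoord : ∀ s j, (a j).toMul (ψ s) = Circle.exp (s j) := by
    intro s j
    rw [hψχ]
    congr 1
    have h1 : ∀ i, (((N : ℚ)⁻¹ • g) (rationalize _ (a j))) i = if i = j then 1 else 0 := by
      intro i
      rw [← ha, LinearMap.smul_apply, map_zsmul, hgv, ← Int.cast_smul_eq_zsmul ℚ, smul_smul,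
        inv_mul_cancel₀ (by exact_mod_cast hN), one_smul, Pi.single_apply]
    rw [Finset.sum_eq_single j]
    · rw [show Additive.ofMul (a j).toMul = a j from rfl, h1]; simp
    · intro i _ hij
      rw [show Additive.ofMul (a j).toMul = a j from rfl, h1, if_neg hij]; simp
    · simp
  refine not_hasCoveringDimLE_of_injOn ψ hψ (fun s hs t ht hst => ?_) hdim
  ext1 j
  have h1 : Circle.exp (s j) = Circle.exp (t j) := by rw [← hcoord, ← hcoord, hst]
  -- the radius `3` is less than `π`
  have hbound : ∀ u ∈ Metric.closedBall (0 : Fin (d + 1) → ℝ) 3,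
      -Real.pi < u j ∧ u j ≤ Real.pi := by
    intro u hu
    rw [mem_closedBall_zero_iff] at hu
    have h2 := abs_le.1 ((norm_le_pi_norm u j).trans hu)
    have := Real.pi_gt_three
    constructor <;> linarith [h2.1, h2.2]
  have h2 := congrArg (fun z : Circle => Complex.arg z) h1
  simp only [Circle.arg_exp (hbound s hs).1 (hbound s hs).2,
    Circle.arg_exp (hbound t ht).1 (hbound t ht).2] at h2
  exact h2

end Rank

/-! ### Mixing subsets of `d + 1` elements -/

section Subsets

variable {X : Type*} [CommGroup X] [TopologicalSpace X] [MeasurableSpace X] {m : Measure X}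

/-- Testing the mixing of `F` on families that are all of `X` outside `E`. -/
theorem IsMixingSet.subset [IsProbabilityMeasure m] {E F : Finset (X →ₜ* X)} (hF : IsMixingSet m F)
    (hEF : E ⊆ F) (hE : 1 < E.card) : IsMixingSet m E := by
  classical
  refine ⟨hE, fun B hB => ?_⟩
  have h := hF.2 (fun γ => if γ ∈ E then B γ else Set.univ) fun γ _ => by
    by_cases hγ : γ ∈ E
    · simpa only [if_pos hγ] using hB γ hγ
    · simp only [if_neg hγ, MeasurableSet.univ.nullMeasurableSet]
  have h1 : ∏ γ ∈ F, m (if γ ∈ E then B γ else Set.univ) = ∏ γ ∈ E, m (B γ) := by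
    rw [← Finset.prod_subset hEF (f := fun γ => m (if γ ∈ E then B γ else Set.univ))
      fun γ _ hγ => by simp only [if_neg hγ, measure_univ]]
    exact Finset.prod_congr rfl fun γ hγ => by rw [if_pos hγ]
  have h2 : ∀ n : ℕ, ⋂ γ ∈ F, (⇑γ)^[n] ⁻¹' (if γ ∈ E then B γ else Set.univ) =
      ⋂ γ ∈ E, (⇑γ)^[n] ⁻¹' B γ := by
    intro n
    ext x
    simp only [Set.mem_iInter]
    refine ⟨fun hx γ hγ => by simpa only [if_pos hγ] using hx γ (hEF hγ), fun hx γ _ => ?_⟩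
    by_cases hγ : γ ∈ E
    · simpa only [if_pos hγ] using hx γ hγ
    · simp only [if_neg hγ, Set.preimage_univ, Set.mem_univ]
  simpa only [h1, h2] using h

end Subsets

section Main

variable {X : Type*} [CommGroup X] [TopologicalSpace X] [IsTopologicalGroup X]
  [CompactSpace X] [T2Space X] [ConnectedSpace X] [MeasurableSpace X] [BorelSpace X]
  (m : Measure X) [m.IsHaarMeasure] [m.Regular] [IsProbabilityMeasure m]

include m in
theorem subsingleton_of_finrank_eq_zero
    [FiniteDimensional ℚ (TensorProduct ℤ ℚ (Additive (X →ₜ* Circle)))]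
    (h : Module.finrank ℚ (TensorProduct ℤ ℚ (Additive (X →ₜ* Circle))) = 0) :
    Subsingleton X := by
  have hV := Module.finrank_zero_iff.1 h
  refine subsingleton_of_forall_eq 1 fun x => ?_
  by_contra hx
  obtain ⟨χ, hχ⟩ := exists_character_ne_one m hx
  have h1 : Additive.ofMul χ = 0 :=
    rationalize_injective zsmul_character_eq_zero_imp (Subsingleton.elim _ _)
  have h2 : χ = 1 := h1
  exact hχ (by rw [h2]; rfl)

/-- The dual of an endomorphism as a linear map of the additive character group. -/
noncomputable def dualLinearMap (γ : X →ₜ* X) : Module.End ℤ (Additive (X →ₜ* Circle)) :=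
  (MonoidHom.toAdditive (dualHom γ)).toIntLinearMap

theorem dualLinearMap_pow_apply (γ : X →ₜ* X) (n : ℕ) (χ : X →ₜ* Circle) :
    (dualLinearMap γ ^ n) (Additive.ofMul χ) = Additive.ofMul ((dualHom γ ^ n) χ) := by
  induction n generalizing χ with
  | zero => rfl
  | succ n ih =>
    rw [pow_succ, pow_succ, Module.End.mul_apply]
    exact ih (dualHom γ χ)

end Main

theorem mainTheorem2 {X : Type*} [CommGroup X] [TopologicalSpace X] [IsTopologicalGroup X]
    [CompactSpace X] [T2Space X] [ConnectedSpace X] [MeasurableSpace X] [BorelSpace X]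
    (m : Measure X) [m.IsHaarMeasure] [m.Regular] [IsProbabilityMeasure m]
    (d : ℕ) (hd : coveringDim X = (d : ℕ∞))
    (F : Finset (X →ₜ* X)) (hF : ∀ γ ∈ F, Function.Surjective γ) (hcard : d < F.card) :
    IsMixingSet m F ↔ ∀ E ⊆ F, E.card = d + 1 → IsMixingSet m E := by
  classical
  have hrank := rank_rationalized_characters_le m (hasCoveringDimLE_of_coveringDim_eq hd)
  have hfin : FiniteDimensional ℚ (TensorProduct ℤ ℚ (Additive (X →ₜ* Circle))) :=
    Module.rank_lt_aleph0_iff.1 (hrank.trans_lt (Cardinal.natCast_lt_aleph0))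
  have hfinrank := Module.finrank_le_of_rank_le hrank
  constructor
  · intro hmix E hEF hE
    refine hmix.subset hEF ?_
    rw [hE]
    -- in dimension zero the group is trivial and has a single endomorphism
    by_contra hd0
    have hX := subsingleton_of_finrank_eq_zero m (by omega)
    have hF1 : F.card ≤ 1 := Finset.card_le_one.2 fun a _ b _ =>
      ContinuousMonoidHom.ext fun x => Subsingleton.elim _ _
    exact absurd hmix.1 hF1.not_gt
  · intro hall
    obtain ⟨E₀, hE₀F, hE₀⟩ := Finset.exists_subset_card_eq (Nat.succ_le_of_lt hcard)
    refine isMixingSet_of_eventually_prod_ne_one m hF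
      ((hall E₀ hE₀F hE₀).1.trans_le (Finset.card_le_card hE₀F)) fun χ hχ => ?_
    by_contra hev
    obtain ⟨γ₀, hγ₀, hχγ₀⟩ := hχ
    have hfreq : {n : ℕ | ∏ γ ∈ F, (dualHom γ ^ n) (χ γ) = 1}.Infinite := by
      rw [← Nat.frequently_atTop_iff_infinite]
      simpa only [not_eventually, not_not] using hev
    obtain ⟨E, hE, c, ⟨i, hiE, hci⟩, hinf⟩ := exists_infinite_relations_of_infinite_relations
      (ι := F) zsmul_character_eq_zero_imp hfinrank (by rwa [Fintype.card_coe])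
      (fun γ => dualLinearMap γ.1) (fun γ => dualHom_injective (hF γ.1 γ.2))
      (fun γ => Additive.ofMul (χ γ.1))
      (Function.ne_iff.2 ⟨⟨γ₀, hγ₀⟩, hχγ₀⟩)
      (hfreq.mono fun n hn => by
        rw [Set.mem_ofPred_eq] at hn ⊢
        simp only [dualLinearMap_pow_apply]
        rw [← ofMul_prod, Finset.prod_coe_sort F fun γ => (dualHom γ ^ n) (χ γ), hn, ofMul_one])
    let χ' : (X →ₜ* X) → (X →ₜ* Circle) := fun γ => if h : γ ∈ F then (c ⟨γ, h⟩).toMul else 1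
    have hχ' : ∀ γ : F, χ' γ.1 = (c γ).toMul := fun γ => dif_pos γ.2
    have hmix := hall (E.map (Function.Embedding.subtype (· ∈ F)))
      (fun γ hγ => by
        obtain ⟨δ, -, rfl⟩ := Finset.mem_map.1 hγ
        exact δ.2)
      (by rw [Finset.card_map, hE])
    have hne := hmix.eventually_prod_ne_one m χ'
      ⟨i.1, Finset.mem_map_of_mem _ hiE, by rw [hχ']; exact hci⟩
    refine (Nat.frequently_atTop_iff_infinite.2 hinf) (hne.mono fun n hn h0 => hn ?_)
    rw [Finset.prod_map]
    change ∏ γ ∈ E, (dualHom γ.1 ^ n) (χ' γ.1) = 1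
    have h1 : ∀ γ : F, (dualLinearMap γ.1 ^ n) (c γ) =
        Additive.ofMul ((dualHom γ.1 ^ n) (χ' γ.1)) := fun γ => by
      rw [hχ']
      exact dualLinearMap_pow_apply γ.1 n (c γ).toMul
    simp only [h1] at h0
    rw [← ofMul_prod] at h0
    exact h0
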